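/- Let $r\ge 2$, $s\ge 2$. Let $X_1,\dots,X_n$ be a Hall basis of rank $r$ and step $s$, i.e. a list of formal commutators built by M. Hall's algorithm: it starts with the generators $X_1,\dots,X_r$ (degree $1$), it is ordered so that $d(i)<d(j)$ implies $i<j$ (the order within one degree being arbitrary), and $[X_i,X_j]$ with $d(i)+d(j)\le s$ belongs to the list if and only if $i>j$ and, in case $X_i$ was constructed as $[X_h,X_k]$, $k\le j$. Each $X_\ell$ is uniquely a left-normed commutator $[\cdots[[X_{\ell_0},X_{\ell_1}],X_{\ell_2}],\dots,X_{\ell_h}]$, $h\ge 0$, with $\ell_0\le r$; let $I(\ell)\in\mathbb N^n$, $I(\ell)_j=\#\{m\ge1:\ell_m=j\}$, and for $q\le r$ write $q\prec\ell$ if $\ell_0=q$. For a multi-index $\alpha\in\mathbb N^n$ put $|\alpha|=\sum_j\alpha_j$, $\alpha!=\prod_j\alpha_j!$, $x^\alpha=\prod_j x_j^{\alpha_j}$. Realize $X_1,\dots,X_n$ as polynomial vector fields on $\mathbb R^n$ (the Hall–Grayson–Grossman basis): for $q\le r$, $$X_q(x)=\sum_{\ell:\,q\prec\ell}\frac{(-1)^{|I(\ell)|}}{I(\ell)!}\,x^{I(\ell)}\,\frac{\partial}{\partial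 x_\ell},$$ and for $q>r$ the field $X_q$ is the corresponding commutator of vector fields. Let $[X_i,X_\alpha]$ be the left-normed commutator $[X_i,X_1,\dots,X_1,\dots,X_n,\dots,X_n]$, with $X_j$ repeated $\alpha_j$ times. Define structure constants $c_{ij}^k$ and generalized structure constants $c_{i\alpha}^k$ by $[X_i,X_j]=\sum_k c_{ij}^kX_k$, $[X_i,X_\alpha]=\sum_k c_{i\alpha}^kX_k$, and, for $v\in\mathbb R^n$, the extremal polynomials $$P_i^v(x)=\sum_{\alpha\in\mathbb N^n}\frac{(-1)^{|\alpha|}}{\alpha!}\Big(\sum_{k=1}^n c_{i\alpha}^k v_k\Big)x^\alpha,\qquad i=1,\dots,n.$$ These objects are well defined and $\mathbb R^n$ is the free nilpotent group of rank $r$ and step $s$ in exponential coordinates of the second type, in the following sense: $X_1,\dots,X_n$ is a basis of the Lie algebra generated by $X_1,\dots,X_r$, which is free nilpotent of step $s$ on these generators; $x=e^{x_1X_1}\circ\cdots\circ e^{x_nX_n}(0)$ for all $x\in\mathbb R^n$, where $e^{tX}$ is the flow of $X$; and for each $i$ only finitely many $[X_i,X_\alpha]$ are nonzero. Moreover, let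 $\gamma:[0,1]\to\mathbb R^n$ be a horizontal curve with $\gamma(0)=0$ (i.e. $\gamma$ is Lipschitz and $\dot\gamma=\sum_{q=1}^r h_qX_q(\gamma)$ a.e. on $[0,1]$ for some $h_1,\dots,h_r\in L^\infty([0,1])$), and let $\lambda:[0,1]\to\mathbb R^n$ be a Lipschitz curve. The following are equivalent: A) $\lambda$ solves the adjoint system $\dot\lambda_i=-\sum_{k=1}^n\sum_{j=1}^r c_{ij}^k\,\dot\gamma_j\,\lambda_k$ a.e. on $[0,1]$, $i=1,\dots,n$; B) there exists $v\in\mathbb R^n$ such that $\lambda_i(t)=P_i^v(\gamma(t))$ for all $i=1,\dots,n$ and all $t\in[0,1]$; and any $v$ as in B) is equal to $\lambda(0)$. -/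

import Mathlib

open MeasureTheory

noncomputable section

namespace HallGG

/-! ### Hall systems -/

/-- A Hall system of rank `r` and step `s`: a list `word 0, …, word (n - 1)` of bracket words in
the generators, as produced by M. Hall's algorithm (indices start at `0`). The bracket word `a * b`
stands for the commutator `[a, b]` and `FreeMagma.length` is the degree. The list starts with the
generators, is ordered by degree (the order among words of equal degree is arbitrary), and a
commutator `[a, b]` of degree at most `s` is listed exactly when `a = word i`, `b = word j` are
listed, `j < i`, and `k ≤ j` whenever `a` was constructed as `[word h, word k]`. -/
structure HallSystem (r s n : ℕ) where
  word : Fin n → FreeMagma (Fin r)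
  rank_le : r ≤ n
  word_injective : Function.Injective word
  word_gen : ∀ q : Fin r, word (Fin.castLE rank_le q) = FreeMagma.of q
  length_mono : ∀ i j : Fin n, i ≤ j → (word i).length ≤ (word j).length
  mul_mem_iff : ∀ a b : FreeMagma (Fin r),
    (a * b ∈ Set.range word) ↔
      a.length + b.length ≤ s ∧
        ∃ i j : Fin n, word i = a ∧ word j = b ∧ j < i ∧
          ∀ h k : Fin n, a = word h * word k → k ≤ j

/-- The factors `w₁, …, w_h` (with multiplicity) of a bracket word written as a left-normed
commutator `[⋯[[x, w₁], w₂], …, w_h]` of a generator `x`. -/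
def factors {r : ℕ} : FreeMagma (Fin r) → Multiset (FreeMagma (Fin r))
  | .of _ => 0
  | .mul a b => b ::ₘ factors a

/-- `IsDescendant u w`: the word `w` is `[⋯[[u, w₁], w₂], …, w_m]` for some `m ≥ 0` and some
words `w₁, …, w_m` (direct descendant). -/
def IsDescendant {r : ℕ} (u : FreeMagma (Fin r)) : FreeMagma (Fin r) → Prop
  | .of a => u = .of a
  | .mul a b => u = .mul a b ∨ IsDescendant u a

/-- The value in a Lie algebra of a bracket word. -/
def evalWord {r : ℕ} {L : Type*} [LieRing L] (f : Fin r → L) : FreeMagma (Fin r) → L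
  | .of a => f a
  | .mul a b => ⁅evalWord f a, evalWord f b⁆

/-! ### Polynomial vector fields on `ℝⁿ` -/

/-- Polynomial vector fields on `ℝⁿ`, as derivations of the polynomial ring. The Lie bracket is the
commutator `[X, Y] f = X (Y f) - Y (X f)`. -/
abbrev PolyField (n : ℕ) : Type :=
  Derivation ℝ (MvPolynomial (Fin n) ℝ) (MvPolynomial (Fin n) ℝ)

/-- The value of a polynomial vector field at a point. -/
def PolyField.at {n : ℕ} (Y : PolyField n) (x : Fin n → ℝ) : Fin n → ℝ :=
  fun l => MvPolynomial.eval x (Y (MvPolynomial.X l))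

/-- `q = exp(t Y) p`: the integral curve of `Y` that starts at `p` is at `q` at time `t`. -/
def FlowsTo {n : ℕ} (Y : PolyField n) (t : ℝ) (p q : Fin n → ℝ) : Prop :=
  ∃ c : ℝ → Fin n → ℝ, c 0 = p ∧ c t = q ∧ ∀ τ : ℝ, HasDerivAt c (Y.at (c τ)) τ

/-- The free nilpotent Lie algebra of rank `r` and step `s`. -/
abbrev FreeNilpotentLie (r s : ℕ) : Type :=
  FreeLieAlgebra ℝ (Fin r) ⧸
    LieModule.lowerCentralSeries ℝ (FreeLieAlgebra ℝ (Fin r)) (FreeLieAlgebra ℝ (Fin r)) s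

namespace HallSystem

variable {r s n : ℕ} (H : HallSystem r s n)

/-- The multi-index `I(ℓ)`: `I(ℓ)_j` counts how often `word j` is a factor of `word ℓ`. -/
def multiIndex (l : Fin n) : Fin n → ℕ :=
  fun j => (factors (H.word l)).count (H.word j)

open Classical in
/-- The Grayson–Grossman generators
`X_q = ∑_{ℓ : q ≺ ℓ} (-1)^{|I(ℓ)|} / I(ℓ)! x^{I(ℓ)} ∂/∂x_ℓ`. -/
def generator (q : Fin r) : PolyField n :=
  MvPolynomial.mkDerivation ℝ fun l =>
    if IsDescendant (FreeMagma.of q) (H.word l) then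
      MvPolynomial.C ((-1 : ℝ) ^ (∑ j, H.multiIndex l j) /
          ((∏ j, (H.multiIndex l j).factorial : ℕ) : ℝ)) *
        ∏ j, MvPolynomial.X j ^ H.multiIndex l j
    else 0

/-- The Hall–Grayson–Grossman vector fields `X_1, …, X_n`. -/
def field (i : Fin n) : PolyField n :=
  evalWord H.generator (H.word i)

/-- The iterated commutator `[X_i, X_α] = [X_i, X_1, …, X_1, …, X_n, …, X_n]` (left-normed, with
`X_j` repeated `α_j` times). -/
def iterBracket (i : Fin n) (α : Fin n → ℕ) : PolyField n :=
  (List.finRange n).foldl (fun Y j => (fun Z => ⁅Z, H.field j⁆)^[α j] Y) (H.field i)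

open Classical in
/-- The coordinates of a vector field with respect to `X_1, …, X_n` (and `0` for a vector field
that is not a linear combination of them). -/
def coords (Y : PolyField n) : Fin n → ℝ :=
  if h : ∃ a : Fin n → ℝ, Y = ∑ k, a k • H.field k then h.choose else 0

/-- The structure constants `c_{ij}^k`: `[X_i, X_j] = ∑_k c_{ij}^k X_k`. -/
def structConst (i j k : Fin n) : ℝ :=
  H.coords ⁅H.field i, H.field j⁆ k

/-- The generalized structure constants `c_{iα}^k`: `[X_i, X_α] = ∑_k c_{iα}^k X_k`. -/
def genStructConst (i : Fin n) (α : Fin n → ℕ) (k : Fin n) : ℝ :=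
  H.coords (H.iterBracket i α) k

/-- `φ_{iα}(v) = (-1)^{|α|} / α! ∑_k c_{iα}^k v_k`. -/
def phi (i : Fin n) (α : Fin n → ℕ) (v : Fin n → ℝ) : ℝ :=
  (-1 : ℝ) ^ (∑ j, α j) / ((∏ j, (α j).factorial : ℕ) : ℝ) * ∑ k, H.genStructConst i α k * v k

/-- The extremal polynomial `P_i^v(x) = ∑_{α ∈ ℕⁿ} φ_{iα}(v) x^α`. -/
def extremalPoly (i : Fin n) (v x : Fin n → ℝ) : ℝ :=
  ∑ᶠ α : Fin n → ℕ, H.phi i α v * ∏ j, x j ^ α j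

/-- `γ : [0,1] → ℝⁿ` is a horizontal curve: it is Lipschitz and `γ' = ∑_q h_q X_q(γ)` a.e. on
`[0,1]` for some controls `h_1, …, h_r ∈ L^∞([0,1])`. -/
def IsHorizontal (γ : ℝ → Fin n → ℝ) : Prop :=
  (∃ K : NNReal, LipschitzOnWith K γ (Set.Icc 0 1)) ∧
    ∃ h : Fin r → ℝ → ℝ,
      (∀ q, MemLp (h q) ⊤ (volume.restrict (Set.Icc (0 : ℝ) 1))) ∧
      ∀ᵐ t ∂(volume.restrict (Set.Icc (0 : ℝ) 1)),
        HasDerivAt γ (∑ q, h q t • (H.generator q).at (γ t)) t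

/-- `μ : [0,1] → ℝⁿ` solves the adjoint system along `γ`:
`μ_i' = - ∑_{k=1}^n ∑_{j=1}^r c_{ij}^k γ_j' μ_k` a.e. on `[0,1]`, for every `i`. -/
def SolvesAdjoint (γ μ : ℝ → Fin n → ℝ) : Prop :=
  ∀ i : Fin n, ∀ᵐ t ∂(volume.restrict (Set.Icc (0 : ℝ) 1)),
    HasDerivAt (fun τ => μ τ i)
      (-∑ k : Fin n, ∑ q : Fin r,
        H.structConst i (Fin.castLE H.rank_le q) k *
          deriv (fun τ => γ τ (Fin.castLE H.rank_le q)) t * μ t k) t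

/-- `X_1, …, X_n` is a basis of the Lie algebra of vector fields generated by `X_1, …, X_r`, and
this Lie algebra is free nilpotent of step `s` on these generators. -/
def IsFreeNilpotentBasis : Prop :=
  LinearIndependent ℝ H.field ∧
    (LieSubalgebra.lieSpan ℝ (PolyField n) (Set.range H.generator)).toSubmodule =
      Submodule.span ℝ (Set.range H.field) ∧
    ∃ e : FreeNilpotentLie r s ≃ₗ⁅ℝ⁆
        LieSubalgebra.lieSpan ℝ (PolyField n) (Set.range H.generator),
      ∀ q : Fin r,
        ((e (LieSubmodule.Quotient.mk (FreeLieAlgebra.of ℝ q)) :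
            LieSubalgebra.lieSpan ℝ (PolyField n) (Set.range H.generator)) : PolyField n) =
          H.generator q

/-- The coordinates of `ℝⁿ` are exponential coordinates of the second type with respect to
`X_1, …, X_n`: `x = exp(x_1 X_1) ∘ ⋯ ∘ exp(x_n X_n) (0)` for all `x`. Here `p i.succ` is the point
before, and `p i.castSucc` the point after the flow along the field with index `i` is applied. -/
def IsSecondTypeCoordinates : Prop :=
  ∀ x : Fin n → ℝ, ∃ p : Fin (n + 1) → Fin n → ℝ,
    p (Fin.last n) = 0 ∧ p 0 = x ∧
      ∀ i : Fin n, FlowsTo (H.field i) (x i) (p i.succ) (p i.castSucc)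

end HallSystem

end HallGG

end

noncomputable section

namespace HallGG

open MvPolynomial

/-! ### Bracket words in Lie algebras -/

section Words

variable {r : ℕ} {L L' : Type*} [LieRing L] [LieRing L']

/-! The engine is Lazard elimination: removing a free generator `x` from a free Lie algebra leaves
an ideal that is free on the brackets `[u, x, …, x]`, with `u` the other generators. For Hall words
taken in order, the words of index at least `i` span a subalgebra whose free generators are the
`Admissible` words. To each such word `u` belongs the field `∑ (-x)^α / α! ∂_{uα}` in the remaining
variables (`partialField`); on the full list these are the Grayson–Grossman generators. Bracketing
with `∂_j` appends the factor `word j`, and putting `x_j = 0` passes to the next stage. Hence `X_i =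
∂_i` where `x_j = 0` for all `j < i` (`field_at`), which gives linear independence at the origin and
the second-type coordinates.

Freeness follows by comparison. Hall's collection process makes the Hall words span the free
nilpotent algebra, their images are independent, and weights under dilations kill all longer
brackets (`evalWord_generator_eq_zero`, `ker_toField`).

For the adjoint system, `P_i^v` is the series `∑ (-x)^α / α! v([X_i, X_α](0))`. The same
elimination, with the Leibniz rule for iterated brackets, gives `X_q P_i^v = -∑_k c_{iq}^k P_k^v`
(`partialField_extremal`). By the chain rule `P^v(γ)` solves the system, with value `v` at time `0`
because `γ(0) = 0`. Brackets raise the degree, so the system is strictly triangular and its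
solutions are determined by their initial values. -/

@[simp] theorem evalWord_of (f : Fin r → L) (q : Fin r) : evalWord f (.of q) = f q := rfl

@[simp] theorem evalWord_mul (f : Fin r → L) (a b : FreeMagma (Fin r)) :
    evalWord f (a * b) = ⁅evalWord f a, evalWord f b⁆ := rfl

variable [LieAlgebra ℝ L] [LieAlgebra ℝ L']

theorem length_mul (a b : FreeMagma (Fin r)) : (a * b).length = a.length + b.length := rfl

theorem mul_inj {a b c d : FreeMagma (Fin r)} : a * b = c * d ↔ a = c ∧ b = d := by
  constructor
  · intro h
    cases h
    exact ⟨rfl, rfl⟩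
  · rintro ⟨rfl, rfl⟩
    rfl

theorem of_ne_mul (q : Fin r) (a b : FreeMagma (Fin r)) : FreeMagma.of q ≠ a * b := by
  intro h
  cases h

theorem map_evalWord (φ : L →ₗ⁅ℝ⁆ L') (f : Fin r → L) (w : FreeMagma (Fin r)) :
    φ (evalWord f w) = evalWord (fun q => φ (f q)) w := by
  induction w with
  | ih1 q => rfl
  | ih2 a b ha hb => simp [ha, hb]

/-- The span of the values of the bracket words of length greater than `k`. -/
def wordSpan (f : Fin r → L) (k : ℕ) : Submodule ℝ L :=
  Submodule.span ℝ {x | ∃ w : FreeMagma (Fin r), k < w.length ∧ evalWord f w = x}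

theorem evalWord_mem_wordSpan (f : Fin r → L) {k : ℕ} {w : FreeMagma (Fin r)}
    (h : k < w.length) : evalWord f w ∈ wordSpan f k :=
  Submodule.subset_span ⟨w, h, rfl⟩

/-- A property of brackets may be checked on spanning sets. -/
theorem lie_mem_of_mem_span {A B : Set L} {S : Submodule ℝ L}
    (h : ∀ x ∈ A, ∀ y ∈ B, ⁅x, y⁆ ∈ S) {x y : L} (hx : x ∈ Submodule.span ℝ A)
    (hy : y ∈ Submodule.span ℝ B) : ⁅x, y⁆ ∈ S := by
  induction hx using Submodule.span_induction with
  | zero => simp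
  | add a b _ _ ha hb => rw [add_lie]; exact S.add_mem ha hb
  | smul c a _ ha => rw [smul_lie]; exact S.smul_mem c ha
  | mem x hx =>
    induction hy using Submodule.span_induction with
    | zero => simp
    | add a b _ _ ha hb => rw [lie_add]; exact S.add_mem ha hb
    | smul c a _ ha => rw [lie_smul]; exact S.smul_mem c ha
    | mem y hy => exact h x hx y hy

theorem lie_mem_wordSpan {f : Fin r → L} {j k : ℕ} {x y : L} (hx : x ∈ wordSpan f j)
    (hy : y ∈ wordSpan f k) : ⁅x, y⁆ ∈ wordSpan f (j + k + 1) := by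
  refine lie_mem_of_mem_span ?_ hx hy
  rintro _ ⟨a, ha, rfl⟩ _ ⟨b, hb, rfl⟩
  exact evalWord_mem_wordSpan (w := a * b) f (by rw [length_mul]; omega)

/-- A Lie subalgebra of a free Lie algebra that contains the generators is everything. -/
theorem freeLieAlgebra_eq_top (S : LieSubalgebra ℝ (FreeLieAlgebra ℝ (Fin r)))
    (h : ∀ q, FreeLieAlgebra.of ℝ q ∈ S) (x : FreeLieAlgebra ℝ (Fin r)) : x ∈ S := by
  let g : FreeLieAlgebra ℝ (Fin r) →ₗ⁅ℝ⁆ S := FreeLieAlgebra.lift ℝ fun q => ⟨_, h q⟩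
  have : S.incl.comp g = LieHom.id := by
    apply FreeLieAlgebra.hom_ext
    intro q
    simp [g]
  have hx := LieHom.congr_fun this x
  simp only [LieHom.comp_apply, LieHom.id_apply] at hx
  rw [← hx]
  exact (g x).2

theorem wordSpan_freeLieAlgebra (x : FreeLieAlgebra ℝ (Fin r)) :
    x ∈ wordSpan (FreeLieAlgebra.of ℝ) 0 := by
  let S : LieSubalgebra ℝ (FreeLieAlgebra ℝ (Fin r)) :=
    { wordSpan (FreeLieAlgebra.of ℝ) 0 with
      lie_mem' := by
        intro x y hx hy
        refine lie_mem_of_mem_span ?_ hx hy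
        rintro _ ⟨a, ha, rfl⟩ _ ⟨b, hb, rfl⟩
        exact evalWord_mem_wordSpan (w := a * b) _ (by rw [length_mul]; omega) }
  exact freeLieAlgebra_eq_top S
    (fun q => evalWord_mem_wordSpan (w := .of q) _ Nat.one_pos) x

/-- The series starts with the whole algebra at `0`, so its `k`-th term corresponds to words of
length at least `k + 1`. -/
theorem lowerCentralSeries_le_wordSpan (k : ℕ) {x : FreeLieAlgebra ℝ (Fin r)}
    (hx : x ∈ LieModule.lowerCentralSeries ℝ (FreeLieAlgebra ℝ (Fin r))
      (FreeLieAlgebra ℝ (Fin r)) k) : x ∈ wordSpan (FreeLieAlgebra.of ℝ) k := by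
  induction k generalizing x with
  | zero => exact wordSpan_freeLieAlgebra x
  | succ k ih =>
    rw [LieModule.lowerCentralSeries_succ, ← LieSubmodule.mem_toSubmodule,
      LieSubmodule.lieIdeal_oper_eq_linear_span'] at hx
    refine Submodule.span_le.2 ?_ hx
    rintro _ ⟨y, -, z, hz, rfl⟩
    simpa using lie_mem_wordSpan (wordSpan_freeLieAlgebra y) (ih hz)

/-- The series is built by bracketing with one element at a time, whereas words are arbitrary trees.
The Jacobi identity unfolds the action of a word into successive actions of its letters. -/
theorem lie_evalWord_mem_lowerCentralSeries (f : Fin r → L) (w : FreeMagma (Fin r)) (k : ℕ)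
    {y : L} (hy : y ∈ LieModule.lowerCentralSeries ℝ L L k) :
    ⁅evalWord f w, y⁆ ∈ LieModule.lowerCentralSeries ℝ L L (k + w.length) := by
  induction w generalizing k y with
  | ih1 q =>
    change _ ∈ LieModule.lowerCentralSeries ℝ L L (k + 1)
    rw [LieModule.lowerCentralSeries_succ]
    exact LieSubmodule.lie_mem_lie (LieSubmodule.mem_top _) hy
  | ih2 a b ha hb =>
    rw [evalWord_mul, lie_lie, length_mul]
    refine sub_mem ?_ ?_
    · have := ha _ (hb _ hy)
      rwa [add_assoc, add_comm b.length] at this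
    · have := hb _ (ha _ hy)
      rwa [add_assoc] at this

theorem evalWord_mem_lowerCentralSeries (f : Fin r → L) (w : FreeMagma (Fin r)) :
    evalWord f w ∈ LieModule.lowerCentralSeries ℝ L L (w.length - 1) := by
  induction w with
  | ih1 q => exact LieSubmodule.mem_top _
  | ih2 a b _ hb =>
    have := lie_evalWord_mem_lowerCentralSeries f a _ hb
    have hpos := b.length_pos
    rwa [show b.length - 1 + a.length = (a * b).length - 1 by rw [length_mul]; omega] at this

/-- The quotient map onto the free nilpotent Lie algebra. -/
def toFreeNilpotent (r s : ℕ) : FreeLieAlgebra ℝ (Fin r) →ₗ⁅ℝ⁆ FreeNilpotentLie r s :=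
  { (LieSubmodule.Quotient.mk' (LieModule.lowerCentralSeries ℝ (FreeLieAlgebra ℝ (Fin r))
      (FreeLieAlgebra ℝ (Fin r)) s) : FreeLieAlgebra ℝ (Fin r) →ₗ[ℝ] FreeNilpotentLie r s) with
    map_lie' := fun {x y} => LieSubmodule.Quotient.mk_bracket _ x y }

theorem toFreeNilpotent_eq_zero {s : ℕ} {x : FreeLieAlgebra ℝ (Fin r)} :
    toFreeNilpotent r s x = 0 ↔ x ∈ LieModule.lowerCentralSeries ℝ (FreeLieAlgebra ℝ (Fin r))
      (FreeLieAlgebra ℝ (Fin r)) s :=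
  LieSubmodule.Quotient.mk_eq_zero _

theorem evalWord_freeNilpotent_eq_zero {s : ℕ} {w : FreeMagma (Fin r)} (hw : s < w.length) :
    evalWord (fun q => toFreeNilpotent r s (FreeLieAlgebra.of ℝ q)) w = 0 := by
  rw [← map_evalWord, toFreeNilpotent_eq_zero]
  exact LieModule.antitone_lowerCentralSeries ℝ _ _ (by omega : s ≤ w.length - 1)
    (evalWord_mem_lowerCentralSeries _ w)

/-- First isomorphism theorem with prescribed kernel and range. -/
theorem exists_quotient_equiv {I : LieIdeal ℝ L} {S : LieSubalgebra ℝ L'} (φ : L →ₗ⁅ℝ⁆ L')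
    (hI : φ.ker = I) (hS : φ.range = S) :
    ∃ e : (L ⧸ I) ≃ₗ⁅ℝ⁆ S, ∀ x : L, (e (LieSubmodule.Quotient.mk x) : L') = φ x := by
  subst hI hS
  exact ⟨φ.quotKerEquivRange, fun x => rfl⟩

end Words

/-! ### Combinatorics of Hall systems -/

namespace HallSystem

variable {r s n : ℕ} (H : HallSystem r s n)

theorem lt_of_length_lt {i j : Fin n} (h : (H.word i).length < (H.word j).length) : i < j := by
  by_contra hij
  exact absurd (H.length_mono j i (not_lt.1 hij)) (not_le.2 h)

theorem exists_of_mul_mem {a b : FreeMagma (Fin r)} (h : a * b ∈ Set.range H.word) :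
    ∃ i j : Fin n, H.word i = a ∧ H.word j = b ∧ j < i ∧
      ∀ h k : Fin n, a = H.word h * H.word k → k ≤ j :=
  ((H.mul_mem_iff a b).1 h).2

theorem left_mem {a b : FreeMagma (Fin r)} (h : a * b ∈ Set.range H.word) :
    a ∈ Set.range H.word := by
  obtain ⟨i, -, hi, -⟩ := H.exists_of_mul_mem h
  exact ⟨i, hi⟩

theorem length_le (hs : 1 ≤ s) (i : Fin n) : (H.word i).length ≤ s := by
  generalize hw : H.word i = w
  induction w with
  | ih1 q => exact hs
  | ih2 a b _ _ => exact ((H.mul_mem_iff a b).1 ⟨i, hw⟩).1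

/-! ### Hall's collection process: the Hall words span -/

variable {L : Type*} [LieRing L] [LieAlgebra ℝ L]

/-- The span of the values of the Hall words of length `N`. -/
def hallSpan (f : Fin r → L) (N : ℕ) : Submodule ℝ L :=
  Submodule.span ℝ {x | ∃ i : Fin n, (H.word i).length = N ∧ evalWord f (H.word i) = x}

theorem evalWord_mem_hallSpan (f : Fin r → L) (i : Fin n) :
    evalWord f (H.word i) ∈ H.hallSpan f (H.word i).length :=
  Submodule.subset_span ⟨i, rfl, rfl⟩

/-- If `[word i, word j]` is short enough but not listed, then `word i = [c, d]` with `j < d < c`,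
and Jacobi gives `[[c, j], d] - [[d, j], c]`. The inner brackets have smaller total length, so they
are combinations of Hall words; these are longer than `word j`, hence of index above `j`. What
remains are brackets of two words of index above `j`. The outer induction is on the total length,
the inner one runs downwards in `j`. -/
theorem lie_mem_hallSpan_of_lt (f : Fin r → L)
    (hf : ∀ w : FreeMagma (Fin r), s < w.length → evalWord f w = 0) (N : ℕ) (j i : Fin n)
    (hij : j < i) (hN : (H.word i).length + (H.word j).length = N) :
    ⁅evalWord f (H.word i), evalWord f (H.word j)⁆ ∈ H.hallSpan f N := by
  induction N using Nat.strong_induction_on generalizing j i with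
  | _ N ihN =>
  induction hd : n - j.val using Nat.strong_induction_on generalizing j i with
  | _ d ihd =>
  subst hd
  -- the bracket of two listed words that are larger than `word j`
  have key : ∀ k l : Fin n, j < k → j < l → (H.word k).length + (H.word l).length = N →
      ⁅evalWord f (H.word k), evalWord f (H.word l)⁆ ∈ H.hallSpan f N := by
    intro k l hk hl hkl
    rcases lt_trichotomy k l with h | h | h
    · rw [← lie_skew]
      exact neg_mem (ihd _ (by omega) k l h (by omega) rfl)
    · subst h; simp
    · exact ihd _ (by omega) l k h hkl rfl
  have hjpos := (H.word j).length_pos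
  by_cases hlen : s < N
  · rw [← evalWord_mul, hf _ (by rw [length_mul]; omega)]
    exact zero_mem _
  by_cases hmem : H.word i * H.word j ∈ Set.range H.word
  · obtain ⟨k, hk⟩ := hmem
    rw [← evalWord_mul, ← hk]
    refine Submodule.subset_span ⟨k, ?_, rfl⟩
    rw [hk, length_mul, hN]
  · rw [H.mul_mem_iff] at hmem
    have : ∃ h k : Fin n, H.word i = H.word h * H.word k ∧ j < k := by
      by_contra hcon
      push Not at hcon
      exact hmem ⟨by omega, i, j, rfl, rfl, hij, hcon⟩
    obtain ⟨c, d, hcd, hjd⟩ := this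
    have hdc : d < c := by
      obtain ⟨c', d', hc', hd', hlt, -⟩ := H.exists_of_mul_mem ⟨i, hcd⟩
      rwa [← H.word_injective hc', ← H.word_injective hd']
    have hl : (H.word i).length = (H.word c).length + (H.word d).length := by
      rw [hcd, length_mul]
    have hcpos := (H.word c).length_pos
    have hdpos := (H.word d).length_pos
    have hspan : ∀ (k l : Fin n), j < k → j < l →
        (H.word k).length + (H.word l).length + (H.word j).length = N →
        ⁅⁅evalWord f (H.word k), evalWord f (H.word j)⁆, evalWord f (H.word l)⁆ ∈
          H.hallSpan f N := by
      intro k l hk hl' hkl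
      have hlpos := (H.word l).length_pos
      have h1 := ihN ((H.word k).length + (H.word j).length) (by omega) j k hk rfl
      refine lie_mem_of_mem_span ?_ h1
        (Submodule.mem_span_singleton_self (R := ℝ) (evalWord f (H.word l)))
      rintro _ ⟨m, hm, rfl⟩ _ rfl
      have hkpos := (H.word k).length_pos
      exact key m l (H.lt_of_length_lt (by omega)) hl' (by omega)
    have h1 := hspan c d (hjd.trans hdc) hjd (by omega)
    have h2 := hspan d c hjd (hjd.trans hdc) (by omega)
    have jacobi : ∀ x y z : L, ⁅⁅x, y⁆, z⁆ = ⁅⁅x, z⁆, y⁆ - ⁅⁅y, z⁆, x⁆ := by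
      intro x y z
      rw [lie_lie, ← lie_skew ⁅x, z⁆ y, ← lie_skew ⁅y, z⁆ x]
      abel
    rw [hcd, evalWord_mul, jacobi]
    exact sub_mem h1 h2

theorem lie_mem_hallSpan (f : Fin r → L)
    (hf : ∀ w : FreeMagma (Fin r), s < w.length → evalWord f w = 0) (i j : Fin n) :
    ⁅evalWord f (H.word i), evalWord f (H.word j)⁆ ∈
      H.hallSpan f ((H.word i).length + (H.word j).length) := by
  rcases lt_trichotomy i j with h | h | h
  · rw [← lie_skew, add_comm]
    exact neg_mem (H.lie_mem_hallSpan_of_lt f hf _ i j h rfl)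
  · subst h; simp
  · exact H.lie_mem_hallSpan_of_lt f hf _ j i h rfl

/-- The Hall words span: every bracket word is a combination of Hall words of the same length. -/
theorem evalWord_mem_hallSpan_length (f : Fin r → L)
    (hf : ∀ w : FreeMagma (Fin r), s < w.length → evalWord f w = 0) (w : FreeMagma (Fin r)) :
    evalWord f w ∈ H.hallSpan f w.length := by
  induction w with
  | ih1 q => exact H.word_gen q ▸ H.evalWord_mem_hallSpan f _
  | ih2 a b ha hb =>
    refine lie_mem_of_mem_span ?_ ha hb
    rintro _ ⟨i, hi, rfl⟩ _ ⟨j, hj, rfl⟩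
    rw [length_mul, ← hi, ← hj]
    exact H.lie_mem_hallSpan f hf i j

theorem hallSpan_le (f : Fin r → L) (N : ℕ) :
    H.hallSpan f N ≤ Submodule.span ℝ (Set.range fun i => evalWord f (H.word i)) :=
  Submodule.span_mono (by rintro _ ⟨i, -, rfl⟩; exact ⟨i, rfl⟩)

theorem evalWord_mem_span (f : Fin r → L)
    (hf : ∀ w : FreeMagma (Fin r), s < w.length → evalWord f w = 0) (w : FreeMagma (Fin r)) :
    evalWord f w ∈ Submodule.span ℝ (Set.range fun i => evalWord f (H.word i)) :=
  H.hallSpan_le f _ (H.evalWord_mem_hallSpan_length f hf w)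

/-- `u ↦ [u, word j]` on bracket words. -/
def mulWord (j : Fin n) (u : FreeMagma (Fin r)) : FreeMagma (Fin r) := u * H.word j

theorem evalWord_iterate_mulWord {L : Type*} [LieRing L] (f : Fin r → L) (j : Fin n) (k : ℕ)
    (u : FreeMagma (Fin r)) :
    evalWord f ((H.mulWord j)^[k] u) = (fun Z => ⁅Z, evalWord f (H.word j)⁆)^[k] (evalWord f u) := by
  induction k with
  | zero => rfl
  | succ k ih => rw [Function.iterate_succ_apply', Function.iterate_succ_apply', ← ih]; rfl

theorem length_iterate_mulWord (j : Fin n) (k : ℕ) (u : FreeMagma (Fin r)) :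
    ((H.mulWord j)^[k] u).length = u.length + k * (H.word j).length := by
  induction k with
  | zero => simp
  | succ k ih => rw [Function.iterate_succ_apply', mulWord, length_mul, ih]; ring

theorem lt_length_iterate_mulWord (j : Fin n) (k : ℕ) (u : FreeMagma (Fin r)) :
    k < ((H.mulWord j)^[k] u).length := by
  rw [length_iterate_mulWord]
  have := u.length_pos
  have := Nat.le_mul_of_pos_right k (H.word j).length_pos
  omega

theorem mem_range_of_iterate_mulWord {j : Fin n} {k : ℕ} {u : FreeMagma (Fin r)}
    (h : (H.mulWord j)^[k] u ∈ Set.range H.word) : u ∈ Set.range H.word := by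
  induction k with
  | zero => exact h
  | succ k ih =>
    rw [Function.iterate_succ_apply'] at h
    exact ih (H.left_mem h)

theorem not_mul_self_mem {i j : Fin n} (h : i ≤ j) :
    H.word i * H.word j ∉ Set.range H.word := by
  intro hmem
  obtain ⟨i', j', hi, hj, hlt, -⟩ := H.exists_of_mul_mem hmem
  rw [H.word_injective hi, H.word_injective hj] at hlt
  exact absurd hlt (not_lt.2 h)

/-! ### Lazard elimination on Hall words -/

/-- The increasing enumeration of an upper set of indices. -/
def IsUpper (l : List (Fin n)) : Prop :=
  l.Pairwise (· < ·) ∧ ∀ i ∈ l, ∀ j, i ≤ j → j ∈ l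

theorem isUpper_finRange : IsUpper (List.finRange n) :=
  ⟨List.pairwise_lt_finRange n, fun _ _ j _ => List.mem_finRange j⟩

theorem IsUpper.tail {j : Fin n} {l : List (Fin n)} (h : IsUpper (j :: l)) : IsUpper l := by
  obtain ⟨hp, hu⟩ := h
  rw [List.pairwise_cons] at hp
  refine ⟨hp.2, fun i hi k hik => ?_⟩
  have := hp.1 i hi
  rcases List.mem_cons.1 (hu i (List.mem_cons_of_mem _ hi) k hik) with rfl | h
  · exact absurd hik (not_le.2 this)
  · exact h

theorem IsUpper.mem_tail_iff {j : Fin n} {l : List (Fin n)} (h : IsUpper (j :: l)) {i : Fin n} :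
    i ∈ l ↔ j < i := by
  obtain ⟨hp, hu⟩ := h
  rw [List.pairwise_cons] at hp
  refine ⟨hp.1 i, fun hi => ?_⟩
  rcases List.mem_cons.1 (hu j List.mem_cons_self i hi.le) with rfl | h
  · exact absurd hi (lt_irrefl _)
  · exact h

/-- The listed words with index in `l` that are generators or whose last factor is not in `l`:
the free generators of the Lie algebra spanned by the words with index in `l`. -/
def Admissible (l : List (Fin n)) (u : FreeMagma (Fin r)) : Prop :=
  (∃ i ∈ l, H.word i = u) ∧ ∀ (a : FreeMagma (Fin r)) (j : Fin n), u = a * H.word j → j ∉ l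

variable {H} {l : List (Fin n)} {j : Fin n} {u : FreeMagma (Fin r)}

theorem Admissible.tail (hu : H.Admissible (j :: l) u) (hne : u ≠ H.word j) :
    H.Admissible l u := by
  obtain ⟨⟨i, hi, rfl⟩, h⟩ := hu
  refine ⟨⟨i, ?_, rfl⟩, fun a k hk hkl => h a k hk (List.mem_cons_of_mem _ hkl)⟩
  rcases List.mem_cons.1 hi with rfl | hi
  · exact absurd rfl hne
  · exact hi

/-- Hall's condition for appending `word j` is that the last factor of the word has index at most
`j`. This is admissibility for `l`, since `l` consists of the indices above `j`. -/
theorem Admissible.mulWord (hl : IsUpper (j :: l)) (hu : H.Admissible l u)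
    (hlen : u.length + (H.word j).length ≤ s) : H.Admissible l (H.mulWord j u) := by
  obtain ⟨⟨i, hi, rfl⟩, h⟩ := hu
  have hji := hl.mem_tail_iff.1 hi
  obtain ⟨k, hk⟩ : H.word i * H.word j ∈ Set.range H.word := by
    refine (H.mul_mem_iff _ _).2 ⟨hlen, i, j, rfl, rfl, hji, fun a k hk => ?_⟩
    have := h _ k hk
    rw [hl.mem_tail_iff] at this
    exact not_lt.1 this
  refine ⟨⟨k, hl.mem_tail_iff.2 (hji.trans (H.lt_of_length_lt ?_)), hk⟩, fun a k' hk' => ?_⟩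
  · rw [hk, length_mul]
    have := (H.word j).length_pos
    omega
  · rw [HallSystem.mulWord, mul_inj] at hk'
    rw [← H.word_injective hk'.2, hl.mem_tail_iff]
    exact lt_irrefl _

theorem Admissible.iterate (hl : IsUpper (j :: l)) (hu : H.Admissible l u) (k : ℕ) :
    H.Admissible l ((H.mulWord j)^[k] u) ∨ s < ((H.mulWord j)^[k] u).length := by
  induction k with
  | zero => exact Or.inl hu
  | succ k ih =>
    rw [Function.iterate_succ_apply']
    by_cases hlen : ((H.mulWord j)^[k] u).length + (H.word j).length ≤ s
    · refine Or.inl ((ih.resolve_right ?_).mulWord hl hlen)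
      omega
    · exact Or.inr (not_le.1 hlen)

/-- Trailing factors `word j` are stripped off one by one; Hall's condition bounds the preceding
factor by `j`, so admissibility persists. With `Admissible.iterate` this is the elimination step:
the generators for `l` are the brackets of the other generators for `j :: l` with copies of `word
j`. -/
theorem Admissible.exists_iterate (hl : IsUpper (j :: l)) (hu : H.Admissible l u) :
    ∃ (u₀ : FreeMagma (Fin r)) (k : ℕ), H.Admissible (j :: l) u₀ ∧ u₀ ≠ H.word j ∧
      u = (H.mulWord j)^[k] u₀ := by
  induction u with
  | ih1 q =>
    obtain ⟨⟨i, hi, hiq⟩, -⟩ := hu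
    refine ⟨.of q, 0, ⟨⟨i, List.mem_cons_of_mem _ hi, hiq⟩,
      fun a k hk => absurd hk (of_ne_mul _ _ _)⟩, ?_, rfl⟩
    rw [← hiq]
    exact fun h => absurd (hl.mem_tail_iff.1 hi) (by rw [H.word_injective h]; exact lt_irrefl _)
  | ih2 a b iha _ =>
    obtain ⟨⟨i, hi, hiq⟩, h⟩ := hu
    by_cases hb : b = H.word j
    · subst hb
      obtain ⟨i', j', hi', hj', hlt, hle⟩ := H.exists_of_mul_mem ⟨i, hiq⟩
      obtain rfl := H.word_injective hj'
      obtain ⟨u₀, k, h₀, hne, hk⟩ := iha ⟨⟨i', hl.mem_tail_iff.2 hlt, hi'⟩, fun c k hk => by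
        rw [hl.mem_tail_iff, not_lt]
        obtain ⟨c', hc'⟩ := H.left_mem (hk ▸ ⟨i', hi'⟩ : c * H.word k ∈ Set.range H.word)
        exact hle c' k (hc' ▸ hk)⟩
      refine ⟨u₀, k + 1, h₀, hne, ?_⟩
      rw [Function.iterate_succ_apply', ← hk]
      rfl
    · refine ⟨a * b, 0, ⟨⟨i, List.mem_cons_of_mem _ hi, hiq⟩, fun c k hk hkl => ?_⟩, ?_, rfl⟩
      · rcases List.mem_cons.1 hkl with rfl | hkl
        · exact hb (mul_inj.1 hk).2
        · exact h c k hk hkl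
      · rw [← hiq]
        exact fun h => absurd (hl.mem_tail_iff.1 hi) (by rw [H.word_injective h]; exact lt_irrefl _)

end HallSystem

/-! ### Iterated exponential series -/

section IterSeries

variable {n : ℕ}

/-- The divided power `(-x_j)^k / k!`. -/
def divPow (j : Fin n) (k : ℕ) : MvPolynomial (Fin n) ℝ :=
  C ((-1 : ℝ) ^ k / (k.factorial : ℝ)) * X j ^ k

@[simp] theorem divPow_zero (j : Fin n) : divPow j 0 = 1 := by simp [divPow]

theorem pderiv_divPow_succ (j : Fin n) (k : ℕ) :
    pderiv j (divPow j (k + 1)) = -divPow j k := by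
  have h : ((-1 : ℝ) ^ (k + 1) / ((k + 1).factorial : ℝ)) * (k + 1) =
      -((-1 : ℝ) ^ k / (k.factorial : ℝ)) := by
    have := Nat.cast_ne_zero (R := ℝ).2 k.factorial_ne_zero
    rw [Nat.factorial_succ, pow_succ]
    push_cast
    field_simp
  rw [divPow, divPow, pderiv_C_mul, pderiv_pow, pderiv_X_self, mul_one, Nat.add_sub_cancel,
    ← mul_assoc, ← neg_mul, ← map_neg, ← h, map_mul]
  simp

theorem pderiv_divPow_of_ne {i j : Fin n} (h : j ≠ i) (k : ℕ) : pderiv i (divPow j k) = 0 := by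
  rw [divPow, pderiv_C_mul, pderiv_pow, pderiv_X_of_ne h]
  simp

/-- This binomial coefficient is the one that the Leibniz rule for iterated brackets produces in
`partialField_extremal`. -/
theorem divPow_mul (j : Fin n) (p q : ℕ) :
    divPow j p * divPow j q = ((p + q).choose p) • divPow j (p + q) := by
  have h : ((-1 : ℝ) ^ p / (p.factorial : ℝ)) * ((-1 : ℝ) ^ q / (q.factorial : ℝ)) =
      ((p + q).choose p : ℝ) * ((-1 : ℝ) ^ (p + q) / ((p + q).factorial : ℝ)) := by
    have h1 := Nat.cast_ne_zero (R := ℝ).2 p.factorial_ne_zero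
    have h2 := Nat.cast_ne_zero (R := ℝ).2 q.factorial_ne_zero
    rw [Nat.cast_add_choose, pow_add]
    have h3 := Nat.cast_ne_zero (R := ℝ).2 (p + q).factorial_ne_zero
    field_simp
  rw [divPow, divPow, divPow, mul_mul_mul_comm, ← pow_add, ← map_mul, h, map_mul, nsmul_eq_mul,
    mul_assoc]
  simp

variable {S : Type*} (s : ℕ) (step : Fin n → S → S) (o : S → ℝ)

/-- `∑ (-x)^α / α! · o (step^α u)`, the iteration being carried out along the list. -/
def iterSeries : List (Fin n) → S → MvPolynomial (Fin n) ℝ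
  | [], u => C (o u)
  | j :: l, u => ∑ k ∈ Finset.range (s + 1), divPow j k * iterSeries l ((step j)^[k] u)

variable {s step o}

theorem iterSeries_eq_zero {p : S → Prop} {l : List (Fin n)}
    (hstep : ∀ j ∈ l, ∀ u, p u → p (step j u)) (ho : ∀ u, p u → o u = 0) {u : S} (hu : p u) :
    iterSeries s step o l u = 0 := by
  induction l generalizing u with
  | nil => simp [iterSeries, ho u hu]
  | cons j l ih =>
    refine Finset.sum_eq_zero fun k _ => ?_
    rw [ih (fun i hi => hstep i (List.mem_cons_of_mem _ hi)), mul_zero]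
    exact Function.Iterate.rec p hu (fun u => hstep j List.mem_cons_self u) k

theorem pderiv_iterSeries_of_notMem {l : List (Fin n)} {i : Fin n} (hi : i ∉ l) (u : S) :
    pderiv i (iterSeries s step o l u) = 0 := by
  induction l generalizing u with
  | nil => simp [iterSeries]
  | cons j l ih =>
    rw [List.mem_cons, not_or] at hi
    simp only [iterSeries, map_sum, pderiv_mul, ih hi.2, pderiv_divPow_of_ne (Ne.symm hi.1),
      zero_mul, mul_zero, add_zero, Finset.sum_const_zero]

/-- Differentiation lowers the divided power and so shifts the series by one step. The hypothesis
supplies the term `k = s` that the truncation loses in the shift. -/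
theorem pderiv_iterSeries_cons {l : List (Fin n)} {j : Fin n} (hj : j ∉ l) {u : S}
    (hu : iterSeries s step o l ((step j)^[s + 1] u) = 0) :
    pderiv j (iterSeries s step o (j :: l) u) = -iterSeries s step o (j :: l) (step j u) := by
  simp only [iterSeries, map_sum, pderiv_mul, pderiv_iterSeries_of_notMem hj, mul_zero, add_zero]
  rw [Finset.sum_range_succ', Finset.sum_range_succ, ← Function.iterate_succ_apply, hu]
  simp [pderiv_divPow_succ]

/-! ### Restriction to coordinate subspaces -/

/-- Setting the variables with index outside `l` equal to zero. -/
def killOutside (l : List (Fin n)) : MvPolynomial (Fin n) ℝ →ₐ[ℝ] MvPolynomial (Fin n) ℝ :=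
  aeval fun i => if i ∈ l then X i else 0

theorem killOutside_X (l : List (Fin n)) (i : Fin n) :
    killOutside l (X i) = if i ∈ l then X i else 0 := by
  simp [killOutside]

theorem killOutside_divPow_of_mem {l : List (Fin n)} {j : Fin n} (hj : j ∈ l) (k : ℕ) :
    killOutside l (divPow j k) = divPow j k := by
  rw [divPow, map_mul, map_pow, killOutside_X, if_pos hj, killOutside, ← algebraMap_eq,
    AlgHom.commutes]

theorem killOutside_divPow_succ {l : List (Fin n)} {j : Fin n} (hj : j ∉ l) (k : ℕ) :
    killOutside l (divPow j (k + 1)) = 0 := by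
  rw [divPow, map_mul, map_pow, killOutside_X, if_neg hj]
  simp

theorem killOutside_iterSeries {l l' : List (Fin n)} (h : l ⊆ l') (u : S) :
    killOutside l' (iterSeries s step o l u) = iterSeries s step o l u := by
  induction l generalizing u with
  | nil => simp [iterSeries, killOutside]
  | cons j l ih =>
    rw [List.cons_subset] at h
    simp only [iterSeries, map_sum, map_mul, ih h.2, killOutside_divPow_of_mem h.1]

theorem killOutside_comp {l l' : List (Fin n)} (h : l ⊆ l') (f : MvPolynomial (Fin n) ℝ) :
    killOutside l (killOutside l' f) = killOutside l f := by
  have : (killOutside l).comp (killOutside l') = killOutside l := by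
    refine MvPolynomial.algHom_ext fun i => ?_
    rw [AlgHom.comp_apply, killOutside_X, killOutside_X]
    by_cases hi : i ∈ l
    · rw [if_pos (h hi), killOutside_X]
    · split_ifs <;> simp [killOutside_X, hi]
  exact DFunLike.congr_fun this f

theorem eval_killOutside {l : List (Fin n)} {x : Fin n → ℝ} (hx : ∀ i, i ∉ l → x i = 0)
    (f : MvPolynomial (Fin n) ℝ) : eval x (killOutside l f) = eval x f := by
  have : (aeval (R := ℝ) x).comp (killOutside l) = aeval (R := ℝ) x := by
    refine MvPolynomial.algHom_ext fun i => ?_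
    rw [AlgHom.comp_apply, killOutside_X]
    by_cases hi : i ∈ l
    · simp [hi]
    · simp [hi, hx i hi]
  have h := DFunLike.congr_fun this f
  simpa [aeval_eq_eval] using h

/-- The exponents that occur in an iterated series along `l`. -/
def exponents (s : ℕ) (l : List (Fin n)) : Finset (Fin n → ℕ) :=
  Fintype.piFinset fun j => if j ∈ l then Finset.range (s + 1) else {0}

theorem mem_exponents {l : List (Fin n)} {α : Fin n → ℕ} :
    α ∈ exponents s l ↔ ∀ j, if j ∈ l then α j ≤ s else α j = 0 := by
  rw [exponents, Fintype.mem_piFinset]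
  refine forall_congr' fun j => ?_
  split_ifs <;> simp

/-- The state reached after `α j` steps in direction `j`, for `j` along the list. -/
def iterSteps (step : Fin n → S → S) (l : List (Fin n)) (α : Fin n → ℕ) (u : S) : S :=
  l.foldl (fun u j => (step j)^[α j] u) u

theorem iterSteps_congr {l : List (Fin n)} {α β : Fin n → ℕ} (h : ∀ j ∈ l, α j = β j) (u : S) :
    iterSteps step l α u = iterSteps step l β u := by
  induction l generalizing u with
  | nil => rfl
  | cons j l ih =>
    simp only [iterSteps, List.foldl_cons] at ih ⊢
    rw [h j List.mem_cons_self]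
    exact ih (fun i hi => h i (List.mem_cons_of_mem _ hi)) _

/-- The recursive form serves the inductions along the list; the closed form matches the definitions
of `generator` and `extremalPoly`. -/
theorem iterSeries_eq_sum {l : List (Fin n)} (hl : l.Nodup) (u : S) :
    iterSeries s step o l u =
      ∑ α ∈ exponents s l, (∏ j, divPow j (α j)) * C (o (iterSteps step l α u)) := by
  induction l generalizing u with
  | nil =>
    have : exponents s ([] : List (Fin n)) = {fun _ => 0} := by
      ext α
      rw [mem_exponents, Finset.mem_singleton, funext_iff]
      simp
    rw [this, Finset.sum_singleton]
    simp [iterSeries, iterSteps]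
  | cons j l ih =>
    rw [List.nodup_cons] at hl
    simp only [iterSeries, ih hl.2, Finset.mul_sum]
    rw [← Finset.sum_product']
    -- The slot `j` of an exponent supported in `l` is zero, hence free to store `k`.
    refine Finset.sum_nbij' (fun p => Function.update p.2 j p.1)
      (fun α => (α j, Function.update α j 0)) ?_ ?_ ?_ ?_ ?_
    · rintro ⟨k, α⟩ hα
      rw [Finset.mem_product, Finset.mem_range, mem_exponents] at hα
      rw [mem_exponents]
      intro i
      by_cases hi : i = j
      · subst hi
        simpa using Nat.lt_succ_iff.1 hα.1
      · have := hα.2 i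
        simpa [hi] using this
    · intro α hα
      rw [mem_exponents] at hα
      rw [Finset.mem_product, Finset.mem_range, mem_exponents]
      refine ⟨Nat.lt_succ_iff.2 (by simpa using hα j), fun i => ?_⟩
      by_cases hi : i = j
      · subst hi
        simp [hl.1]
      · simpa [hi] using hα i
    · rintro ⟨k, α⟩ hα
      rw [Finset.mem_product, mem_exponents] at hα
      have := hα.2 j
      rw [if_neg hl.1] at this
      simp [← this]
    · intro α _
      simp
    · rintro ⟨k, α⟩ hα
      rw [Finset.mem_product, mem_exponents] at hα
      have h0 : α j = 0 := by
        have := hα.2 j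
        rwa [if_neg hl.1] at this
      have hprod : ∏ i, divPow i (Function.update α j k i) =
          divPow j k * ∏ i, divPow i (α i) := by
        rw [← Finset.mul_prod_erase _ _ (Finset.mem_univ j),
          ← Finset.mul_prod_erase _ (fun i => divPow i (α i)) (Finset.mem_univ j)]
        simp only [Function.update_self, h0, divPow_zero, one_mul]
        congr 1
        refine Finset.prod_congr (M := MvPolynomial (Fin n) ℝ) rfl fun i hi => ?_
        rw [Function.update_of_ne (Finset.ne_of_mem_erase hi)]
      have hiter : iterSteps step (j :: l) (Function.update α j k) u =
          iterSteps step l α ((step j)^[k] u) := by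
        rw [iterSteps, List.foldl_cons, Function.update_self]
        exact iterSteps_congr (fun i hi => Function.update_of_ne
          (by rintro rfl; exact hl.1 hi) _ _) _
      change divPow j k * (_ * C (o (iterSteps step l α ((step j)^[k] u)))) =
        (∏ i, divPow i (Function.update α j k i)) *
          C (o (iterSteps step (j :: l) (Function.update α j k) u))
      rw [hprod, hiter, mul_assoc]

theorem prod_divPow (α : Fin n → ℕ) :
    ∏ j, divPow j (α j) = C ((-1 : ℝ) ^ (∑ j, α j) / ((∏ j, (α j).factorial : ℕ) : ℝ)) *
      ∏ j, X j ^ α j := by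
  simp only [divPow]
  rw [Finset.prod_mul_distrib, ← map_prod, Finset.prod_div_distrib, Finset.prod_pow_eq_pow_sum,
    Nat.cast_prod]

end IterSeries

/-- Two derivations related by an algebra endomorphism on the variables are related. -/
theorem map_derivation_eq {n : ℕ} {D D' : PolyField n}
    (π : MvPolynomial (Fin n) ℝ →ₐ[ℝ] MvPolynomial (Fin n) ℝ)
    (h : ∀ i, π (D (X i)) = D' (π (X i))) (f : MvPolynomial (Fin n) ℝ) :
    π (D f) = D' (π f) := by
  induction f using MvPolynomial.induction_on with
  | C a =>
    have : π (C a) = C a := π.commutes a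
    rw [this]
    simp
  | add p q hp hq => simp [hp, hq]
  | mul_X p i hp => simp [hp, h]

theorem derivation_sum_apply {n : ℕ} {ι : Type*} (t : Finset ι) (D : ι → PolyField n)
    (f : MvPolynomial (Fin n) ℝ) : (∑ k ∈ t, D k) f = ∑ k ∈ t, D k f := by
  have := map_sum Derivation.coeFnAddMonoidHom D t
  simpa only [Finset.sum_apply, Derivation.coeFnAddMonoidHom_apply] using congrFun this f

theorem lie_eigenvector_mul {L : Type*} [LieRing L] [LieAlgebra ℝ L] {e a b : L} {x y : ℝ}
    (ha : ⁅e, a⁆ = x • a) (hb : ⁅e, b⁆ = y • b) : ⁅e, ⁅a, b⁆⁆ = (x + y) • ⁅a, b⁆ := by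
  rw [leibniz_lie, ha, hb, smul_lie, lie_smul, add_smul]

namespace HallSystem

variable {r s n : ℕ} (H : HallSystem r s n)

/-! ### Exponents of Hall words -/

/-- By Hall's condition the factors of a listed word occur in nondecreasing order, so the last one
has the largest index. -/
theorem count_factors_eq_zero {a : FreeMagma (Fin r)} {j k : Fin n}
    (h : a * H.word j ∈ Set.range H.word) (hk : j < k) :
    (factors (a * H.word j)).count (H.word k) = 0 := by
  induction a generalizing j with
  | ih1 q =>
    change (H.word j ::ₘ 0).count (H.word k) = 0
    rw [Multiset.count_cons_of_ne (fun h => hk.ne' (H.word_injective h)), Multiset.count_zero]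
  | ih2 a b iha _ =>
    change (H.word j ::ₘ factors (a * b)).count (H.word k) = 0
    rw [Multiset.count_cons_of_ne (fun h => hk.ne' (H.word_injective h))]
    have hab := H.left_mem h
    obtain ⟨i', j', hi', hj', -, hle⟩ := H.exists_of_mul_mem h
    obtain rfl := H.word_injective hj'
    obtain ⟨c, d, hc, rfl, -, -⟩ := H.exists_of_mul_mem hab
    exact iha hab ((hle c d (by rw [hc])).trans_lt hk)

theorem card_factors_lt (w : FreeMagma (Fin r)) : (factors w).card < w.length := by
  induction w with
  | ih1 q => exact Nat.one_pos
  | ih2 a b ha _ =>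
    change (b ::ₘ factors a).card < a.length + b.length
    rw [Multiset.card_cons]
    have := b.length_pos
    omega

theorem factors_iterate_mulWord (j : Fin n) (k : ℕ) (u : FreeMagma (Fin r)) :
    factors ((H.mulWord j)^[k] u) = k • {H.word j} + factors u := by
  induction k with
  | zero => simp
  | succ k ih =>
    rw [Function.iterate_succ_apply']
    change H.word j ::ₘ factors _ = _
    rw [ih, succ_nsmul', ← Multiset.singleton_add, add_assoc]

theorem count_factors_iterSteps {l : List (Fin n)} (hl : l.Nodup) (α : Fin n → ℕ)
    (u : FreeMagma (Fin r)) (j : Fin n) :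
    (factors (iterSteps H.mulWord l α u)).count (H.word j) =
      (if j ∈ l then α j else 0) + (factors u).count (H.word j) := by
  induction l generalizing u with
  | nil => simp [iterSteps]
  | cons i l ih =>
    rw [List.nodup_cons] at hl
    change (factors (iterSteps H.mulWord l α ((H.mulWord i)^[α i] u))).count (H.word j) = _
    rw [ih hl.2, factors_iterate_mulWord, Multiset.count_add, Multiset.count_nsmul,
      Multiset.count_singleton]
    by_cases hij : j = i
    · subst hij
      simp [hl.1]
    · simp [hij, H.word_injective.eq_iff]

theorem isDescendant_iterate_mulWord {v u : FreeMagma (Fin r)} (h : IsDescendant v u) (j : Fin n)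
    (k : ℕ) : IsDescendant v ((H.mulWord j)^[k] u) := by
  induction k with
  | zero => exact h
  | succ k ih =>
    rw [Function.iterate_succ_apply']
    exact Or.inr ih

theorem isDescendant_iterSteps {v u : FreeMagma (Fin r)} (h : IsDescendant v u)
    (l : List (Fin n)) (α : Fin n → ℕ) : IsDescendant v (iterSteps H.mulWord l α u) := by
  induction l generalizing u with
  | nil => exact h
  | cons i l ih => exact ih (H.isDescendant_iterate_mulWord h i (α i))

theorem iterSteps_eq_self {l : List (Fin n)} {α : Fin n → ℕ} (h : ∀ j ∈ l, α j = 0)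
    (u : FreeMagma (Fin r)) : iterSteps H.mulWord l α u = u := by
  induction l generalizing u with
  | nil => rfl
  | cons i l ih =>
    change iterSteps H.mulWord l α ((H.mulWord i)^[α i] u) = u
    rw [h i List.mem_cons_self]
    exact ih (fun j hj => h j (List.mem_cons_of_mem _ hj)) u

/-- As `α` vanishes beyond `j`, the additional step is the last one performed. -/
theorem iterSteps_add_single {l : List (Fin n)} (hl : l.Pairwise (· < ·)) {α : Fin n → ℕ}
    {j : Fin n} (hj : j ∈ l) (hα : ∀ k, j < k → α k = 0) (u : FreeMagma (Fin r)) :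
    iterSteps H.mulWord l (α + Pi.single j 1) u = iterSteps H.mulWord l α u * H.word j := by
  induction l generalizing u with
  | nil => simp at hj
  | cons i l ih =>
    rw [List.pairwise_cons] at hl
    change iterSteps H.mulWord l _ ((H.mulWord i)^[_] u) =
      iterSteps H.mulWord l α ((H.mulWord i)^[α i] u) * H.word j
    by_cases hij : j = i
    · subst hij
      rw [H.iterSteps_eq_self (fun k hk => hα k (hl.1 k hk)), H.iterSteps_eq_self, Pi.add_apply,
        Pi.single_eq_same, Function.iterate_succ_apply']
      · rfl
      · intro k hk
        simp [hα k (hl.1 k hk), (hl.1 k hk).ne']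
    · rw [← ih hl.2 ((List.mem_cons.1 hj).resolve_left hij)]
      simp [Ne.symm hij]

/-- A Hall word is recovered from its first letter and its multi-index. -/
theorem iterSteps_multiIndex {q : Fin r} {l : Fin n} (h : IsDescendant (.of q) (H.word l)) :
    iterSteps H.mulWord (List.finRange n) (H.multiIndex l) (.of q) = H.word l := by
  change iterSteps H.mulWord _ (fun j => (factors (H.word l)).count (H.word j)) _ = _
  have hmem : H.word l ∈ Set.range H.word := ⟨l, rfl⟩
  revert h hmem
  generalize H.word l = w
  intro h hmem
  induction w with
  | ih1 q' =>
    change FreeMagma.of q = FreeMagma.of q' at h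
    rw [← h]
    exact H.iterSteps_eq_self (fun j _ => Multiset.count_zero _) _
  | ih2 a b iha _ =>
    obtain ⟨i, j, hi, rfl, -, hle⟩ := H.exists_of_mul_mem hmem
    have h' : IsDescendant (.of q) a := Or.resolve_left h (of_ne_mul q _ _)
    have hadd := H.iterSteps_add_single (List.pairwise_lt_finRange n)
      (List.mem_finRange j) (α := fun k => (factors a).count (H.word k)) ?_ (.of q)
    · rw [iha h' ⟨i, hi⟩] at hadd
      refine Eq.trans ?_ hadd
      refine iterSteps_congr (fun k _ => ?_) _
      change (H.word j ::ₘ factors a).count (H.word k) = _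
      rw [Multiset.count_cons, Pi.add_apply, Pi.single_apply]
      simp only [H.word_injective.eq_iff]
    · intro k hk
      cases a with
      | of q' => exact Multiset.count_zero _
      | mul c d =>
        obtain ⟨c', d', hc, rfl, -, -⟩ := H.exists_of_mul_mem (⟨i, hi⟩ : c * d ∈ Set.range H.word)
        exact H.count_factors_eq_zero ⟨i, hi⟩ ((hle c' d' (by rw [hc]; rfl)).trans_lt hk)

/-! ### Partial Grayson–Grossman fields -/

/-- The indicator function of the word with index `i`. -/
def indicator (i : Fin n) (u : FreeMagma (Fin r)) : ℝ := if u = H.word i then 1 else 0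

/-- The field `∑_α (-x)^α / α! ∂_{u α}`, the sum being over exponents supported in `l`, where
`u α` is the left-normed commutator of `u` with the factors `α`. -/
def partialField (l : List (Fin n)) (u : FreeMagma (Fin r)) : PolyField n :=
  mkDerivation ℝ fun i => iterSeries s H.mulWord (H.indicator i) l u

theorem partialField_X (l : List (Fin n)) (u : FreeMagma (Fin r)) (i : Fin n) :
    H.partialField l u (X i) = iterSeries s H.mulWord (H.indicator i) l u :=
  mkDerivation_X _ _ _

theorem partialField_cons (j : Fin n) (l : List (Fin n)) (u : FreeMagma (Fin r)) :
    H.partialField (j :: l) u =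
      ∑ k ∈ Finset.range (s + 1), divPow j k • H.partialField l ((H.mulWord j)^[k] u) := by
  refine derivation_ext fun i => ?_
  rw [partialField_X, derivation_sum_apply]
  simp only [Derivation.smul_apply, partialField_X, smul_eq_mul]
  rfl

theorem partialField_eq_zero {l : List (Fin n)} {u : FreeMagma (Fin r)}
    (hu : u ∉ Set.range H.word) : H.partialField l u = 0 := by
  refine derivation_ext fun i => ?_
  rw [partialField_X]
  refine iterSeries_eq_zero (p := fun u => u ∉ Set.range H.word)
    (fun j _ u hu h => hu (H.left_mem h)) (fun u hu => if_neg ?_) hu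
  rintro rfl
  exact hu ⟨i, rfl⟩

theorem notMem_range_of_lt_length (hs : 1 ≤ s) {u : FreeMagma (Fin r)} (hu : s < u.length) :
    u ∉ Set.range H.word := by
  rintro ⟨i, rfl⟩
  exact absurd (H.length_le hs i) (not_le.2 hu)

/-- Since `∂_j` has constant coefficients, the bracket is minus the `∂_j`-derivative of the
coefficients, which is the shift of the series. -/
theorem lie_partialField_pderiv (hs : 1 ≤ s) {j : Fin n} {l : List (Fin n)} (hj : j ∉ l)
    (u : FreeMagma (Fin r)) :
    ⁅H.partialField (j :: l) u, (pderiv j : PolyField n)⁆ =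
      H.partialField (j :: l) (H.mulWord j u) := by
  refine derivation_ext fun i => ?_
  have h0 : H.partialField (j :: l) u (pderiv j (X i)) = 0 := by
    rw [pderiv_X]
    by_cases h : j = i
    · subst h; simp
    · simp [h]
  rw [Derivation.commutator_apply, h0, partialField_X, partialField_X, pderiv_iterSeries_cons hj,
    zero_sub, neg_neg]
  rw [← partialField_X, H.partialField_eq_zero, Derivation.zero_apply]
  exact H.notMem_range_of_lt_length hs
    ((Nat.lt_succ_self s).trans (H.lt_length_iterate_mulWord j (s + 1) u))

/-- Only the constant term survives: `word i * word j` is never listed for `i ≤ j`, nor is anything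
built on it. -/
theorem partialField_word {l : List (Fin n)} {i : Fin n} (h : ∀ j ∈ l, i ≤ j) :
    H.partialField l (H.word i) = pderiv i := by
  induction l with
  | nil =>
    refine derivation_ext fun k => ?_
    rw [partialField_X, pderiv_X, iterSeries, indicator]
    by_cases h : i = k
    · subst h; simp
    · simp [h, H.word_injective.eq_iff]
  | cons j l ih =>
    rw [partialField_cons, Finset.sum_range_succ', Finset.sum_eq_zero]
    · simp [ih fun j hj => h j (List.mem_cons_of_mem _ hj)]
    · intro k _
      rw [H.partialField_eq_zero, smul_zero]
      intro hmem
      rw [Function.iterate_succ_apply] at hmem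
      exact H.not_mul_self_mem (h j List.mem_cons_self) (H.mem_range_of_iterate_mulWord hmem)

/-- Appending factors lengthens a word, so its index stays in the upper set `l`. The field is thus
tangent to the subspace of the variables in `l`. -/
theorem partialField_X_eq_zero {l : List (Fin n)} (hl : IsUpper l) {u : FreeMagma (Fin r)}
    (hu : ∃ m ∈ l, H.word m = u) {i : Fin n} (hi : i ∉ l) : H.partialField l u (X i) = 0 := by
  rw [partialField_X]
  refine iterSeries_eq_zero (p := fun u => ∀ i, H.word i = u → i ∈ l) ?_ ?_ ?_
  · rintro j - u hu k hk
    obtain ⟨k', hk'⟩ := H.left_mem ⟨k, hk⟩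
    refine hl.2 k' (hu k' hk') k (H.lt_of_length_lt ?_).le
    rw [hk, hk', mulWord, length_mul]
    have := (H.word j).length_pos
    omega
  · intro u hu
    refine if_neg ?_
    rintro rfl
    exact hi (hu i rfl)
  · obtain ⟨m, hm, rfl⟩ := hu
    intro k hk
    rwa [H.word_injective hk]

/-- The fields along the full list are the Grayson–Grossman generators. -/
theorem partialField_finRange_of (hs : 1 ≤ s) (q : Fin r) :
    H.partialField (List.finRange n) (.of q) = H.generator q := by
  refine derivation_ext fun i => ?_
  rw [partialField_X, generator, mkDerivation_X, iterSeries_eq_sum (List.nodup_finRange n)]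
  split_ifs with h
  · rw [Finset.sum_eq_single_of_mem (H.multiIndex i)]
    · rw [H.iterSteps_multiIndex h, indicator, if_pos rfl, map_one, mul_one, prod_divPow]
    · rw [mem_exponents]
      intro j
      rw [if_pos (List.mem_finRange j)]
      exact (Multiset.count_le_card _ _).trans
        ((card_factors_lt _).le.trans (H.length_le hs i))
    -- An exponent that leads to `word i` is recovered by counting the factors of that word.
    · intro α _ hne
      rw [indicator, if_neg, map_zero, mul_zero]
      intro heq
      refine hne (funext fun j => ?_)
      rw [multiIndex, ← heq, H.count_factors_iterSteps (List.nodup_finRange n),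
        if_pos (List.mem_finRange j)]
      exact (congrArg (α j + ·) (Multiset.count_zero _)).symm
  · refine Finset.sum_eq_zero fun α _ => ?_
    rw [indicator, if_neg, map_zero, mul_zero]
    intro heq
    exact h (heq ▸ H.isDescendant_iterSteps (u := .of q) (by rfl) _ _)

/-! ### Nilpotency -/

/-- The generator of the dilations. -/
def euler : PolyField n :=
  ∑ i, ((H.word i).length : MvPolynomial (Fin n) ℝ) • (X i : MvPolynomial (Fin n) ℝ) • pderiv i

theorem euler_apply (f : MvPolynomial (Fin n) ℝ) :
    H.euler f = ∑ i, ((H.word i).length : MvPolynomial (Fin n) ℝ) * (X i * pderiv i f) := by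
  rw [euler, derivation_sum_apply]
  rfl

theorem euler_X (i : Fin n) :
    H.euler (X i) = ((H.word i).length : MvPolynomial (Fin n) ℝ) * X i := by
  rw [euler_apply, Finset.sum_eq_single_of_mem i (Finset.mem_univ i)]
  · simp
  · intro j _ hj
    rw [pderiv_X_of_ne (Ne.symm hj)]
    simp

theorem coeff_euler (f : MvPolynomial (Fin n) ℝ) (m : Fin n →₀ ℕ) :
    coeff m (H.euler f) = (∑ i, (H.word i).length * m i : ℕ) * coeff m f := by
  induction f using MvPolynomial.induction_on' with
  | monomial a c =>
    rw [euler_apply, coeff_sum, Nat.cast_sum, Finset.sum_mul]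
    refine Finset.sum_congr rfl fun i _ => ?_
    rw [X_mul_pderiv_monomial, ← nsmul_eq_mul, coeff_smul, coeff_smul, coeff_monomial]
    split_ifs with h
    · subst h
      simp [mul_assoc]
    · simp
  | add p q hp hq => rw [map_add, coeff_add, hp, hq, coeff_add, mul_add]

/-- Monomials are eigenvectors of `euler` with nonnegative eigenvalues. -/
theorem eq_zero_of_euler_eq {c : ℝ} (hc : c < 0) {f : MvPolynomial (Fin n) ℝ}
    (h : H.euler f = C c * f) : f = 0 := by
  ext m
  have hm := H.coeff_euler f m
  rw [h, coeff_C_mul] at hm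
  have h0 : (0 : ℝ) ≤ (∑ i, (H.word i).length * m i : ℕ) := Nat.cast_nonneg _
  rcases mul_eq_mul_right_iff.1 hm with h1 | h1
  · linarith
  · rw [h1, coeff_zero]

theorem euler_divPow (j : Fin n) (k : ℕ) :
    H.euler (divPow j k) = C ((k * (H.word j).length : ℕ) : ℝ) * divPow j k := by
  rw [divPow, Derivation.leibniz, derivation_C, smul_zero, add_zero, Derivation.leibniz_pow,
    euler_X]
  rcases k with _ | k
  · simp
  · simp only [smul_eq_mul, nsmul_eq_mul, Nat.add_sub_cancel]
    push_cast
    simp only [map_mul, map_add, map_natCast, map_one]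
    ring

/-- The coefficient of `∂_i` is homogeneous: `k` steps in direction `j` contribute weight `k * (word
j).length` through `x_j ^ k` and lengthen `u` by the same amount. -/
theorem euler_iterSeries (i : Fin n) (l : List (Fin n)) (u : FreeMagma (Fin r)) :
    H.euler (iterSeries s H.mulWord (H.indicator i) l u) =
      C (((H.word i).length : ℝ) - u.length) * iterSeries s H.mulWord (H.indicator i) l u := by
  induction l generalizing u with
  | nil =>
    rw [iterSeries, derivation_C, indicator]
    split_ifs with h
    · simp [h]
    · simp
  | cons j l ih =>
    simp only [iterSeries]
    rw [map_sum, Finset.mul_sum]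
    refine Finset.sum_congr rfl fun k _ => ?_
    rw [Derivation.leibniz, ih, euler_divPow, length_iterate_mulWord]
    simp only [smul_eq_mul, map_sub, map_natCast]
    push_cast
    ring

theorem lie_euler_generator (hs : 1 ≤ s) (q : Fin r) :
    ⁅H.euler, H.generator q⁆ = -H.generator q := by
  rw [← H.partialField_finRange_of hs]
  refine derivation_ext fun i => ?_
  rw [Derivation.commutator_apply, euler_X, Derivation.neg_apply, partialField_X, euler_iterSeries,
    Derivation.leibniz, partialField_X]
  have : ((FreeMagma.of q).length : ℝ) = 1 := by norm_num [FreeMagma.length]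
  rw [this, Derivation.map_natCast]
  simp only [smul_eq_mul, map_sub, map_natCast, map_one]
  ring

theorem lie_euler_evalWord (hs : 1 ≤ s) (w : FreeMagma (Fin r)) :
    ⁅H.euler, evalWord H.generator w⁆ = (-(w.length : ℝ)) • evalWord H.generator w := by
  induction w with
  | ih1 q =>
    have : (-((FreeMagma.of q).length : ℝ)) = -1 := by norm_num [FreeMagma.length]
    rw [this]
    exact (H.lie_euler_generator hs q).trans (neg_one_smul ℝ (H.generator q)).symm
  | ih2 a b ha hb =>
    rw [length_mul, Nat.cast_add, neg_add]
    exact lie_eigenvector_mul ha hb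

/-- The `i`-th coefficient would have weight `(word i).length - w.length ≤ s - w.length < 0`. -/
theorem evalWord_generator_eq_zero (hs : 1 ≤ s) {w : FreeMagma (Fin r)} (hw : s < w.length) :
    evalWord H.generator w = 0 := by
  refine derivation_ext fun i => ?_
  have h := congrArg (fun D : PolyField n => D (X i)) (H.lie_euler_evalWord hs w)
  simp only [Derivation.commutator_apply, euler_X, Derivation.leibniz, Derivation.smul_apply] at h
  rw [Derivation.zero_apply]
  refine H.eq_zero_of_euler_eq (c := (H.word i).length - w.length) ?_ ?_
  · have := H.length_le hs i
    rw [sub_neg, Nat.cast_lt]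
    omega
  · rw [sub_eq_iff_eq_add] at h
    rw [h]
    simp only [Derivation.map_natCast, smul_eq_mul, mul_zero, add_zero, map_sub, map_natCast,
      Algebra.smul_def, algebraMap_eq, map_neg]
    ring

end HallSystem

namespace HallSystem

variable {r s n : ℕ} (H : HallSystem r s n)

/-! ### The fields on coordinate subspaces -/

/-- `D` restricts to `D'` on the subspace where the variables outside `l` vanish. -/
def RestrictsTo (l : List (Fin n)) (D D' : PolyField n) : Prop :=
  ∀ f, killOutside l (D f) = D' (killOutside l f)

theorem RestrictsTo.lie {l : List (Fin n)} {D₁ D₁' D₂ D₂' : PolyField n}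
    (h₁ : RestrictsTo l D₁ D₁') (h₂ : RestrictsTo l D₂ D₂') :
    RestrictsTo l ⁅D₁, D₂⁆ ⁅D₁', D₂'⁆ := by
  intro f
  rw [Derivation.commutator_apply, Derivation.commutator_apply, map_sub, h₁, h₂, h₂, h₁]

theorem restrictsTo_partialField {l : List (Fin n)} (hl : IsUpper l) {u : FreeMagma (Fin r)}
    (hu : ∃ m ∈ l, H.word m = u) : RestrictsTo l (H.partialField l u) (H.partialField l u) := by
  refine map_derivation_eq _ fun i => ?_
  rw [killOutside_X]
  split_ifs with hi
  · rw [partialField_X, killOutside_iterSeries (List.Subset.refl l)]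
  · rw [H.partialField_X_eq_zero hl hu hi, map_zero, map_zero]

theorem restrictsTo_iterate_mulWord (hs : 1 ≤ s) {l : List (Fin n)} {j : Fin n} (hj : j ∉ l)
    (hw : RestrictsTo (j :: l) (H.field j) (pderiv j)) {u : FreeMagma (Fin r)}
    (hu : RestrictsTo (j :: l) (evalWord H.generator u) (H.partialField (j :: l) u)) (k : ℕ) :
    RestrictsTo (j :: l) (evalWord H.generator ((H.mulWord j)^[k] u))
      (H.partialField (j :: l) ((H.mulWord j)^[k] u)) := by
  induction k with
  | zero => exact hu
  | succ k ih =>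
    rw [Function.iterate_succ_apply', ← H.lie_partialField_pderiv hs hj]
    exact ih.lie hw

theorem killOutside_partialField_cons {l : List (Fin n)} {j : Fin n} (hj : j ∉ l)
    (u : FreeMagma (Fin r)) (f : MvPolynomial (Fin n) ℝ) :
    killOutside l (H.partialField (j :: l) u f) = killOutside l (H.partialField l u f) := by
  rw [partialField_cons, derivation_sum_apply, map_sum, Finset.sum_range_succ', Finset.sum_eq_zero]
  · simp
  · intro k _
    rw [Derivation.smul_apply, smul_eq_mul, map_mul, killOutside_divPow_succ hj, zero_mul]

theorem admissible_word {j : Fin n} {l : List (Fin n)} (hl : IsUpper (j :: l)) :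
    H.Admissible (j :: l) (H.word j) := by
  refine ⟨⟨j, List.mem_cons_self, rfl⟩, fun a k hk hmem => ?_⟩
  have hlen : (H.word k).length < (H.word j).length := by
    rw [hk, length_mul]
    have := a.length_pos
    omega
  have hkj := H.lt_of_length_lt hlen
  rcases List.mem_cons.1 hmem with rfl | h
  · exact lt_irrefl _ hkj
  · exact lt_asymm hkj (hl.mem_tail_iff.1 h)

theorem IsUpper.partialField_word {j : Fin n} {l : List (Fin n)} (hl : IsUpper (j :: l)) :
    H.partialField (j :: l) (H.word j) = pderiv j :=
  H.partialField_word fun i hi => by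
    rcases List.mem_cons.1 hi with rfl | hi
    · exact le_rfl
    · exact (hl.mem_tail_iff.1 hi).le

/-- Elimination is carried along the list until `i` is its head. At each stage the field of the head
restricts to `∂_j`, bracketing with it produces the next free generators, and setting `x_j = 0`
reduces them to partial fields for the tail. -/
theorem exists_restrictsTo_pderiv (hs : 1 ≤ s) {l : List (Fin n)} (hl : IsUpper l)
    (h : ∀ u, H.Admissible l u → RestrictsTo l (evalWord H.generator u) (H.partialField l u))
    {i : Fin n} (hi : i ∈ l) :
    ∃ l' : List (Fin n), (∀ j, j ∈ l' ↔ i ≤ j) ∧ RestrictsTo l' (H.field i) (pderiv i) := by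
  induction l with
  | nil => simp at hi
  | cons j l ih =>
    have hw : RestrictsTo (j :: l) (H.field j) (pderiv j) := by
      have := h _ (H.admissible_word hl)
      rwa [IsUpper.partialField_word H hl] at this
    have hj : j ∉ l := fun hj => lt_irrefl _ (hl.mem_tail_iff.1 hj)
    rcases List.mem_cons.1 hi with rfl | hi
    · refine ⟨i :: l, fun k => ?_, hw⟩
      rw [List.mem_cons, hl.mem_tail_iff, le_iff_eq_or_lt, eq_comm]
    · refine ih hl.tail (fun u hu f => ?_) hi
      obtain ⟨u₀, k, hu₀, -, rfl⟩ := hu.exists_iterate hl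
      have hsub : l ⊆ j :: l := List.subset_cons_self j l
      rw [← killOutside_comp hsub, H.restrictsTo_iterate_mulWord hs hj hw (h u₀ hu₀) k,
        H.killOutside_partialField_cons hj, H.restrictsTo_partialField hl.tail hu.1,
        killOutside_comp hsub]

theorem eq_of_of_admissible_finRange {u : FreeMagma (Fin r)}
    (hu : H.Admissible (List.finRange n) u) : ∃ q, u = .of q := by
  obtain ⟨⟨i, -, rfl⟩, h⟩ := hu
  rcases hi : H.word i with q | ⟨a, b⟩
  · exact ⟨q, rfl⟩
  · obtain ⟨-, j, -, hj, -⟩ := H.exists_of_mul_mem ⟨i, hi⟩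
    exact absurd (List.mem_finRange j) (h a j (by rw [hi, hj]; rfl))

/-- On the subspace `x_j = 0`, `j < i`, the field `X_i` is `∂_i`. -/
theorem field_at (hs : 1 ≤ s) {i : Fin n} {x : Fin n → ℝ} (hx : ∀ j, j < i → x j = 0) :
    (H.field i).at x = Pi.single i 1 := by
  obtain ⟨l, hl, hres⟩ := H.exists_restrictsTo_pderiv hs isUpper_finRange (fun u hu f => by
    obtain ⟨q, rfl⟩ := H.eq_of_of_admissible_finRange hu
    rw [evalWord_of, ← H.partialField_finRange_of hs]
    exact H.restrictsTo_partialField isUpper_finRange hu.1 f) (List.mem_finRange i)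
  funext k
  have hx' : ∀ j, j ∉ l → x j = 0 := fun j hj => hx j (not_le.1 fun h => hj ((hl j).2 h))
  rw [PolyField.at, ← eval_killOutside hx', hres, killOutside_X]
  split_ifs with hk
  · rw [pderiv_X]
    by_cases hik : i = k
    · subst hik; simp
    · simp [hik]
  · have : k ≠ i := by
      rintro rfl
      exact hk ((hl k).2 le_rfl)
    simp [this]

/-- The intermediate point with index `m` keeps the coordinates `x_k`, `k ≥ m`, and is zero
elsewhere. The flow of `X_i` then takes place where `X_i = ∂_i`, so it is a straight line filling in
the coordinate `x_i`. -/
theorem isSecondTypeCoordinates (hs : 1 ≤ s) : H.IsSecondTypeCoordinates := by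
  intro x
  refine ⟨fun m k => if m.val ≤ k.val then x k else 0, ?_, ?_, fun i => ?_⟩
  · funext k
    simp
  · funext k
    simp
  · refine ⟨fun τ => (fun k => if i.succ.val ≤ k.val then x k else 0) + τ • Pi.single i 1,
      by simp, ?_, fun τ => ?_⟩
    · funext k
      rcases lt_trichotomy k i with h | h | h
      · have h2 : ¬ i.val ≤ k.val := by have := Fin.lt_def.1 h; omega
        simp [h2, h.ne, h.not_gt]
      · subst h
        simp
      · have h2 : i.val ≤ k.val := (Fin.lt_def.1 h).le
        simp [h, h2, h.ne']
    · rw [H.field_at hs]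
      · simpa using ((hasDerivAt_id τ).smul_const (Pi.single i (1 : ℝ) : Fin n → ℝ)).const_add
          (fun k : Fin n => if i.succ.val ≤ k.val then x k else 0)
      · intro j hj
        simp [hj.ne, hj.not_gt]

/-! ### Independence and freeness -/

/-- The value at a point is linear in the field. -/
def valueAt (x : Fin n → ℝ) : PolyField n →ₗ[ℝ] Fin n → ℝ where
  toFun Y := Y.at x
  map_add' Y Z := by
    funext l
    simp [PolyField.at]
  map_smul' c Y := by
    funext l
    simp [PolyField.at, smul_eval]

theorem valueAt_field (hs : 1 ≤ s) (i : Fin n) : valueAt 0 (H.field i) = Pi.single i 1 :=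
  H.field_at hs fun _ _ => rfl

theorem linearIndependent_field (hs : 1 ≤ s) : LinearIndependent ℝ H.field := by
  refine LinearIndependent.of_comp (valueAt 0) ?_
  have : ⇑(valueAt 0) ∘ H.field = ⇑(Pi.basisFun ℝ (Fin n)) := by
    funext i
    rw [Function.comp_apply, H.valueAt_field hs, Pi.basisFun_apply]
  rw [this]
  exact (Pi.basisFun ℝ (Fin n)).linearIndependent

/-- The Hall–Grayson–Grossman fields as images of the free Lie algebra. -/
def toField : FreeLieAlgebra ℝ (Fin r) →ₗ⁅ℝ⁆ PolyField n := FreeLieAlgebra.lift ℝ H.generator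

theorem toField_evalWord (w : FreeMagma (Fin r)) :
    H.toField (evalWord (FreeLieAlgebra.of ℝ) w) = evalWord H.generator w := by
  rw [map_evalWord]
  simp [toField]

theorem range_toField :
    H.toField.range = LieSubalgebra.lieSpan ℝ (PolyField n) (Set.range H.generator) := by
  refine le_antisymm ?_ (LieSubalgebra.lieSpan_le.2 ?_)
  · rintro _ ⟨x, rfl⟩
    refine freeLieAlgebra_eq_top ((LieSubalgebra.lieSpan ℝ (PolyField n)
      (Set.range H.generator)).comap H.toField) (fun q => ?_) x
    rw [LieSubalgebra.mem_comap, toField, FreeLieAlgebra.lift_of_apply]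
    exact LieSubalgebra.subset_lieSpan ⟨q, rfl⟩
  · rintro _ ⟨q, rfl⟩
    exact ⟨FreeLieAlgebra.of ℝ q, FreeLieAlgebra.lift_of_apply _ _⟩

theorem evalWord_mem_span_field (hs : 1 ≤ s) (w : FreeMagma (Fin r)) :
    evalWord H.generator w ∈ Submodule.span ℝ (Set.range H.field) :=
  H.evalWord_mem_span H.generator (fun _ hw => H.evalWord_generator_eq_zero hs hw) w

theorem toField_mem_span_field (hs : 1 ≤ s) (x : FreeLieAlgebra ℝ (Fin r)) :
    H.toField x ∈ Submodule.span ℝ (Set.range H.field) := by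
  have hx := wordSpan_freeLieAlgebra x
  rw [wordSpan] at hx
  induction hx using Submodule.span_induction with
  | zero => rw [map_zero]; exact zero_mem _
  | add a b _ _ ha hb => rw [map_add]; exact add_mem ha hb
  | smul c a _ ha => rw [map_smul]; exact Submodule.smul_mem _ c ha
  | mem a ha =>
    obtain ⟨w, -, rfl⟩ := ha
    rw [toField_evalWord]
    exact H.evalWord_mem_span_field hs w

theorem toFreeNilpotent_mem_span (x : FreeLieAlgebra ℝ (Fin r)) :
    toFreeNilpotent r s x ∈ Submodule.span ℝ (Set.range fun i =>
      toFreeNilpotent r s (evalWord (FreeLieAlgebra.of ℝ) (H.word i))) := by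
  have hx := wordSpan_freeLieAlgebra x
  rw [wordSpan] at hx
  induction hx using Submodule.span_induction with
  | zero => rw [map_zero]; exact zero_mem _
  | add a b _ _ ha hb => rw [map_add]; exact add_mem ha hb
  | smul c a _ ha => rw [map_smul]; exact Submodule.smul_mem _ c ha
  | mem a ha =>
    obtain ⟨w, -, rfl⟩ := ha
    simp only [map_evalWord]
    exact H.evalWord_mem_span _ (fun _ hw => evalWord_freeNilpotent_eq_zero hw) w

/-- One inclusion is nilpotency. For the other, an element of the kernel is, modulo the series, a
combination of Hall words; their images are independent, so all coefficients vanish. -/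
theorem ker_toField (hs : 1 ≤ s) :
    H.toField.ker = LieModule.lowerCentralSeries ℝ (FreeLieAlgebra ℝ (Fin r))
      (FreeLieAlgebra ℝ (Fin r)) s := by
  have hle : ∀ x ∈ LieModule.lowerCentralSeries ℝ (FreeLieAlgebra ℝ (Fin r))
      (FreeLieAlgebra ℝ (Fin r)) s, H.toField x = 0 := by
    intro x hx
    replace hx := lowerCentralSeries_le_wordSpan s hx
    rw [wordSpan] at hx
    induction hx using Submodule.span_induction with
    | zero => rw [map_zero]
    | add a b _ _ ha hb => rw [map_add, ha, hb, add_zero]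
    | smul c a _ ha => rw [map_smul, ha, smul_zero]
    | mem a ha =>
      obtain ⟨w, hw, rfl⟩ := ha
      rw [toField_evalWord, H.evalWord_generator_eq_zero hs hw]
  refine le_antisymm (fun x hx => ?_) fun x hx => LieHom.mem_ker.2 (hle x hx)
  rw [LieHom.mem_ker] at hx
  obtain ⟨c, hc⟩ := (Submodule.mem_span_range_iff_exists_fun ℝ).1 (H.toFreeNilpotent_mem_span x)
  set y := ∑ i, c i • evalWord (FreeLieAlgebra.of ℝ) (H.word i) with hy
  have hxy : toFreeNilpotent r s (x - y) = 0 := by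
    rw [map_sub, ← hc, hy, map_sum]
    simp only [map_smul, sub_self]
  have h0 := hle _ (toFreeNilpotent_eq_zero.1 hxy)
  rw [map_sub, hx, zero_sub, neg_eq_zero, hy, map_sum] at h0
  simp only [map_smul, toField_evalWord] at h0
  have hc0 := Fintype.linearIndependent_iff.1 (H.linearIndependent_field hs) c h0
  rw [← toFreeNilpotent_eq_zero, ← hc]
  exact Finset.sum_eq_zero fun i _ => by rw [hc0 i, zero_smul]

theorem isFreeNilpotentBasis (hs : 1 ≤ s) : H.IsFreeNilpotentBasis := by
  refine ⟨H.linearIndependent_field hs, ?_, ?_⟩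
  · rw [← range_toField]
    refine le_antisymm ?_ (Submodule.span_le.2 ?_)
    · rintro _ ⟨x, rfl⟩
      exact H.toField_mem_span_field hs x
    · rintro _ ⟨i, rfl⟩
      exact ⟨_, H.toField_evalWord (H.word i)⟩
  · obtain ⟨e, he⟩ := exists_quotient_equiv H.toField (H.ker_toField hs) H.range_toField
    exact ⟨e, fun q => (he _).trans (FreeLieAlgebra.lift_of_apply _ _)⟩

/-! ### Iterated commutators -/

theorem iterBracket_eq (i : Fin n) (α : Fin n → ℕ) :
    H.iterBracket i α =
      evalWord H.generator (iterSteps H.mulWord (List.finRange n) α (H.word i)) := by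
  change (List.finRange n).foldl (fun Y j => (fun Z => ⁅Z, H.field j⁆)^[α j] Y)
    (evalWord H.generator (H.word i)) = evalWord H.generator ((List.finRange n).foldl _ (H.word i))
  generalize H.word i = u
  induction List.finRange n generalizing u with
  | nil => rfl
  | cons j l ih =>
    rw [List.foldl_cons, List.foldl_cons, ← ih, evalWord_iterate_mulWord]
    rfl

theorem lt_length_iterSteps (i : Fin n) (α : Fin n → ℕ) (j : Fin n) :
    α j < (iterSteps H.mulWord (List.finRange n) α (H.word i)).length := by
  have h := H.count_factors_iterSteps (List.nodup_finRange n) α (H.word i) j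
  rw [if_pos (List.mem_finRange j)] at h
  exact (Nat.le_add_right _ _).trans_lt (h ▸ (Multiset.count_le_card _ _).trans_lt
    (card_factors_lt _))

theorem iterBracket_eq_zero (hs : 1 ≤ s) (i : Fin n) {α : Fin n → ℕ} {j : Fin n}
    (h : s < α j) : H.iterBracket i α = 0 := by
  rw [iterBracket_eq]
  exact H.evalWord_generator_eq_zero hs (h.trans (H.lt_length_iterSteps i α j))

theorem mem_exponents_of_iterBracket_ne_zero (hs : 1 ≤ s) {i : Fin n} {α : Fin n → ℕ}
    (h : H.iterBracket i α ≠ 0) : α ∈ exponents s (List.finRange n) := by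
  rw [mem_exponents]
  intro j
  rw [if_pos (List.mem_finRange j)]
  exact not_lt.1 fun hj => h (H.iterBracket_eq_zero hs i hj)

theorem finite_iterBracket_ne_zero (hs : 1 ≤ s) (i : Fin n) :
    {α : Fin n → ℕ | H.iterBracket i α ≠ 0}.Finite :=
  (Finset.finite_toSet (exponents s (List.finRange n))).subset fun _ hα =>
    H.mem_exponents_of_iterBracket_ne_zero hs hα

end HallSystem

/-- The iterated exponential series as a linear map, for linear steps. -/
def iterSeriesLinear {n : ℕ} {S : Type*} [AddCommGroup S] [Module ℝ S] (s : ℕ)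
    (f : Fin n → S →ₗ[ℝ] S) (o : S →ₗ[ℝ] ℝ) (l : List (Fin n)) :
    S →ₗ[ℝ] MvPolynomial (Fin n) ℝ where
  toFun := iterSeries s (fun j => f j) o l
  map_add' u v := by
    induction l generalizing u v with
    | nil => simp [iterSeries]
    | cons j l ih => simp only [iterSeries, iterate_map_add, ih, mul_add, Finset.sum_add_distrib]
  map_smul' c u := by
    have h : ∀ (j : Fin n) (k : ℕ) (u : S), (f j)^[k] (c • u) = c • (f j)^[k] u := by
      intro j k u
      rw [← Module.End.coe_pow, map_smul]
    induction l generalizing u with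
    | nil => simp [iterSeries, C_mul']
    | cons j l ih =>
      rw [RingHom.id_apply] at ih ⊢
      simp only [iterSeries, h, Finset.smul_sum, ← mul_smul_comm]
      refine Finset.sum_congr rfl fun k _ => ?_
      rw [ih]

/-- Chain rule for polynomials along a curve with velocity given by derivations. -/
theorem hasDerivAt_eval {n : ℕ} {ι : Type*} [Fintype ι] {γ : ℝ → Fin n → ℝ} {t : ℝ} {h : ι → ℝ}
    {D : ι → PolyField n} (hγ : HasDerivAt γ (∑ q, h q • (D q).at (γ t)) t)
    (p : MvPolynomial (Fin n) ℝ) :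
    HasDerivAt (fun τ => eval (γ τ) p) (∑ q, h q * eval (γ t) (D q p)) t := by
  induction p using MvPolynomial.induction_on with
  | C a => simpa using hasDerivAt_const t a
  | add p q hp hq =>
    simp only [map_add, mul_add, Finset.sum_add_distrib]
    exact hp.add hq
  | mul_X p i hp =>
    have hi := hasDerivAt_pi.1 hγ i
    simp only [map_mul, eval_X]
    refine (hp.mul hi).congr_deriv ?_
    simp only [Derivation.leibniz, smul_eq_mul, map_add, map_mul, eval_X, Finset.sum_apply,
      Pi.smul_apply, PolyField.at, Finset.sum_mul, Finset.mul_sum, mul_add]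
    rw [add_comm, ← Finset.sum_add_distrib]
    exact Finset.sum_congr rfl fun q _ => by ring

namespace HallSystem

variable {r s n : ℕ} (H : HallSystem r s n)

/-! ### Extremal polynomials -/

/-- The covector `v`, applied to the coordinates at the origin. -/
def covector (v : Fin n → ℝ) : PolyField n →ₗ[ℝ] ℝ :=
  (∑ k, v k • LinearMap.proj k) ∘ₗ valueAt 0

theorem covector_apply (v : Fin n → ℝ) (Y : PolyField n) :
    covector v Y = ∑ k, v k * Y.at 0 k := by
  simp [covector, valueAt]

/-- `Z ↦ [Z, X_j]` as a derivation. -/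
def bracketRight (j : Fin n) : LieDerivation ℝ (PolyField n) (PolyField n) :=
  LieDerivation.inner ℝ (PolyField n) (PolyField n) (H.field j)

theorem iterate_bracketRight (j : Fin n) (k : ℕ) (u : FreeMagma (Fin r)) :
    (H.bracketRight j)^[k] (evalWord H.generator u) =
      evalWord H.generator ((H.mulWord j)^[k] u) :=
  (H.evalWord_iterate_mulWord H.generator j k u).symm

/-- The extremal polynomial of a field, with exponents supported in a list. -/
def extremal (v : Fin n → ℝ) (l : List (Fin n)) : PolyField n →ₗ[ℝ] MvPolynomial (Fin n) ℝ :=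
  iterSeriesLinear s (fun j => (H.bracketRight j : PolyField n →ₗ[ℝ] PolyField n)) (covector v) l

theorem extremal_cons (v : Fin n → ℝ) (j : Fin n) (l : List (Fin n)) (Z : PolyField n) :
    H.extremal v (j :: l) Z =
      ∑ k ∈ Finset.range (s + 1), divPow j k * H.extremal v l ((H.bracketRight j)^[k] Z) :=
  rfl

theorem pderiv_extremal_cons (hs : 1 ≤ s) (v : Fin n → ℝ) {j : Fin n} {l : List (Fin n)}
    (hj : j ∉ l) (w : FreeMagma (Fin r)) :
    pderiv j (H.extremal v (j :: l) (evalWord H.generator w)) =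
      H.extremal v (j :: l) ⁅H.field j, evalWord H.generator w⁆ := by
  refine (pderiv_iterSeries_cons hj ?_).trans ?_
  · change H.extremal v l ((H.bracketRight j)^[s + 1] _) = 0
    rw [iterate_bracketRight, H.evalWord_generator_eq_zero hs, map_zero]
    exact (Nat.lt_succ_self s).trans (H.lt_length_iterate_mulWord j (s + 1) w)
  · change -H.extremal v (j :: l) ⁅evalWord H.generator w, H.field j⁆ = _
    rw [← map_neg, lie_skew]

theorem partialField_divPow {l : List (Fin n)} (hl : IsUpper l) {u : FreeMagma (Fin r)}
    (hu : ∃ m ∈ l, H.word m = u) {j : Fin n} (hj : j ∉ l) (k : ℕ) :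
    H.partialField l u (divPow j k) = 0 := by
  rw [divPow, Derivation.leibniz, Derivation.leibniz_pow, H.partialField_X_eq_zero hl hu hj]
  simp

/-- Along the vector field of a free generator, the extremal polynomials are differentiated by
taking brackets. -/
theorem partialField_extremal (hs : 1 ≤ s) (v : Fin n → ℝ) {l : List (Fin n)} (hl : IsUpper l)
    {u : FreeMagma (Fin r)} (hu : H.Admissible l u) (w : FreeMagma (Fin r)) :
    H.partialField l u (H.extremal v l (evalWord H.generator w)) =
      H.extremal v l ⁅evalWord H.generator u, evalWord H.generator w⁆ := by
  induction l generalizing u w with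
  | nil =>
    obtain ⟨⟨i, hi, -⟩, -⟩ := hu
    simp at hi
  | cons j l ih =>
    have hj : j ∉ l := fun hj => lt_irrefl _ (hl.mem_tail_iff.1 hj)
    -- The eliminated generator acts as `∂_j`. Any other `u` is expanded in powers of `x_j`, with
    -- coefficients that are fields of free generators for `l` or zero, to which the induction
    -- hypothesis applies.
    by_cases hne : u = H.word j
    · subst hne
      rw [IsUpper.partialField_word H hl]
      exact H.pderiv_extremal_cons hs v hj w
    set U := evalWord H.generator u with hU
    set W := evalWord H.generator w with hW
    have h0 : ∀ Z : PolyField n, ⁅(0 : PolyField n), Z⁆ = 0 := fun Z => zero_lie Z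
    have hterm : ∀ p k : ℕ,
        H.partialField l ((H.mulWord j)^[p] u) (divPow j k * H.extremal v l ((H.bracketRight j)^[k] W)) =
          divPow j k * H.extremal v l ⁅(H.bracketRight j)^[p] U, (H.bracketRight j)^[k] W⁆ := by
      intro p k
      rw [hU, hW, iterate_bracketRight, iterate_bracketRight]
      rcases (hu.tail hne).iterate hl p with hp | hp
      · rw [Derivation.leibniz, H.partialField_divPow hl.tail hp.1 hj, smul_zero, add_zero,
          ih hl.tail hp, smul_eq_mul]
      · rw [H.partialField_eq_zero (H.notMem_range_of_lt_length hs hp),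
          H.evalWord_generator_eq_zero hs hp, h0, map_zero, mul_zero, Derivation.zero_apply]
    -- This cuts the square `p, k ≤ s` down to the triangle `p + k ≤ s`, which is then summed along
    -- the diagonals `p + k = N`.
    have hzero : ∀ p k : ℕ, s < p + k → ⁅(H.bracketRight j)^[p] U, (H.bracketRight j)^[k] W⁆ = 0 := by
      intro p k hpk
      rw [hU, hW, iterate_bracketRight, iterate_bracketRight, ← evalWord_mul]
      refine H.evalWord_generator_eq_zero hs ?_
      rw [length_mul]
      have := H.lt_length_iterate_mulWord j p u
      have := H.lt_length_iterate_mulWord j k w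
      omega
    rw [partialField_cons, derivation_sum_apply, extremal_cons, extremal_cons]
    simp only [Derivation.smul_apply, map_sum, hterm, smul_eq_mul]
    calc _ = ∑ p ∈ Finset.range (s + 1), ∑ k ∈ Finset.range (s + 1 - p),
          divPow j p * divPow j k * H.extremal v l ⁅(H.bracketRight j)^[p] U, (H.bracketRight j)^[k] W⁆ := by
          refine Finset.sum_congr rfl fun p _ => ?_
          refine (Finset.sum_subset_zero_on_sdiff
            (Finset.range_mono (Nat.sub_le (s + 1) p)) (fun k hk => ?_) fun k _ => ?_).symm
          · rw [Finset.mem_sdiff, Finset.mem_range, Finset.mem_range] at hk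
            rw [hzero p k (by omega), map_zero, mul_zero, mul_zero]
          · rw [mul_assoc]
      _ = ∑ N ∈ Finset.range (s + 1), ∑ p ∈ Finset.range (N + 1),
          divPow j p * divPow j (N - p) *
            H.extremal v l ⁅(H.bracketRight j)^[p] U, (H.bracketRight j)^[N - p] W⁆ :=
          (Finset.sum_range_diag_flip (s + 1) fun p k =>
            divPow j p * divPow j k * H.extremal v l ⁅(H.bracketRight j)^[p] U, (H.bracketRight j)^[k] W⁆).symm
      _ = _ := by
          refine Finset.sum_congr rfl fun N _ => ?_
          -- Leibniz rule for the `N`-th power of `Z ↦ [Z, X_j]`.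
          rw [LieDerivation.iterate_apply_lie', map_sum, Finset.mul_sum]
          refine Finset.sum_congr rfl fun p hp => ?_
          have hpN : p + (N - p) = N := by
            have := Finset.mem_range.1 hp
            omega
          rw [divPow_mul, hpN, map_nsmul, smul_mul_assoc, mul_smul_comm]

theorem admissible_of (q : Fin r) : H.Admissible (List.finRange n) (.of q) :=
  ⟨⟨_, List.mem_finRange _, H.word_gen q⟩, fun _ _ h => absurd h (of_ne_mul _ _ _)⟩

theorem generator_extremal (hs : 1 ≤ s) (v : Fin n → ℝ) (q : Fin r) (i : Fin n) :
    H.generator q (H.extremal v (List.finRange n) (H.field i)) =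
      -H.extremal v (List.finRange n) ⁅H.field i, H.field (Fin.castLE H.rank_le q)⁆ := by
  have h := H.partialField_extremal hs v isUpper_finRange (H.admissible_of q) (H.word i)
  rw [H.partialField_finRange_of hs] at h
  rw [← map_neg, lie_skew]
  change _ = H.extremal v _ ⁅evalWord _ (H.word _), _⁆
  rw [H.word_gen]
  exact h

/-! ### Structure constants -/

theorem eq_sum_coords {Y : PolyField n} (hY : Y ∈ Submodule.span ℝ (Set.range H.field)) :
    Y = ∑ k, H.coords Y k • H.field k := by
  obtain ⟨a, ha⟩ := (Submodule.mem_span_range_iff_exists_fun ℝ).1 hY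
  have h : ∃ a : Fin n → ℝ, Y = ∑ k, a k • H.field k := ⟨a, ha.symm⟩
  rw [coords, dif_pos h]
  exact h.choose_spec

/-- The fields form the standard basis at the origin, so the chosen coordinates are the value there.
-/
theorem coords_eq (hs : 1 ≤ s) {Y : PolyField n}
    (hY : Y ∈ Submodule.span ℝ (Set.range H.field)) : H.coords Y = Y.at 0 := by
  have h := congrArg (valueAt 0) (H.eq_sum_coords hY)
  rw [map_sum] at h
  simp only [map_smul, H.valueAt_field hs] at h
  change Y.at 0 = _ at h
  rw [h]
  funext k
  simp [Finset.sum_apply, Pi.single_apply]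

theorem lie_field_mem_span (hs : 1 ≤ s) (i j : Fin n) :
    ⁅H.field i, H.field j⁆ ∈ Submodule.span ℝ (Set.range H.field) :=
  H.evalWord_mem_span_field hs (H.word i * H.word j)

/-- The bracket is a combination of Hall words strictly longer than `word i`, hence of larger index.
This makes the adjoint system triangular. -/
theorem structConst_eq_zero (hs : 1 ≤ s) {i j k : Fin n} (h : k ≤ i) :
    H.structConst i j k = 0 := by
  have hmem := H.lie_mem_hallSpan H.generator (fun _ hw => H.evalWord_generator_eq_zero hs hw) i j
  rw [structConst, H.coords_eq hs (H.lie_field_mem_span hs i j)]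
  change valueAt 0 ⁅evalWord H.generator (H.word i), evalWord H.generator (H.word j)⁆ k = 0
  rw [hallSpan] at hmem
  generalize ⁅evalWord H.generator (H.word i), evalWord H.generator (H.word j)⁆ = Y at hmem ⊢
  induction hmem using Submodule.span_induction with
  | zero => simp
  | add a b _ _ ha hb => rw [map_add, Pi.add_apply, ha, hb, add_zero]
  | smul c a _ ha => rw [map_smul, Pi.smul_apply, ha, smul_zero]
  | mem a ha =>
    obtain ⟨m, hm, rfl⟩ := ha
    change valueAt 0 (H.field m) k = 0
    have hpos := (H.word j).length_pos
    have him : i < m := H.lt_of_length_lt (by omega)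
    rw [H.valueAt_field hs, Pi.single_eq_of_ne (h.trans_lt him).ne]

theorem generator_extremal_eq_sum (hs : 1 ≤ s) (v : Fin n → ℝ) (q : Fin r) (i : Fin n) :
    H.generator q (H.extremal v (List.finRange n) (H.field i)) =
      -∑ k, H.structConst i (Fin.castLE H.rank_le q) k •
        H.extremal v (List.finRange n) (H.field k) := by
  rw [H.generator_extremal hs]
  nth_rewrite 1 [H.eq_sum_coords (H.lie_field_mem_span hs i (Fin.castLE H.rank_le q))]
  rw [map_sum]
  simp only [map_smul]
  rfl

theorem genStructConst_eq (hs : 1 ≤ s) (i : Fin n) (α : Fin n → ℕ) (k : Fin n) :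
    H.genStructConst i α k = (H.iterBracket i α).at 0 k := by
  rw [genStructConst, H.coords_eq hs]
  rw [iterBracket_eq]
  exact H.evalWord_mem_span_field hs _

theorem phi_eq (hs : 1 ≤ s) (i : Fin n) (α : Fin n → ℕ) (v : Fin n → ℝ) :
    H.phi i α v = (-1 : ℝ) ^ (∑ j, α j) / ((∏ j, (α j).factorial : ℕ) : ℝ) *
      covector v (H.iterBracket i α) := by
  rw [phi, covector_apply]
  simp only [H.genStructConst_eq hs, mul_comm (v _)]

/-- The extremal polynomials are polynomials. -/
theorem extremalPoly_eq_eval (hs : 1 ≤ s) (i : Fin n) (v x : Fin n → ℝ) :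
    H.extremalPoly i v x = eval x (H.extremal v (List.finRange n) (H.field i)) := by
  rw [extremalPoly, finsum_eq_sum_of_support_subset (s := exponents s (List.finRange n))]
  · refine Eq.trans ?_ (congrArg (eval x)
      (iterSeries_eq_sum (s := s) (o := covector v)
        (step := fun j => (H.bracketRight j : PolyField n →ₗ[ℝ] PolyField n))
        (List.nodup_finRange n) (H.field i))).symm
    rw [map_sum]
    refine Finset.sum_congr rfl fun α _ => ?_
    rw [prod_divPow, H.phi_eq hs, map_mul, map_mul, eval_C, eval_C, map_prod]
    simp only [map_pow, eval_X]
    change _ = _ * covector v (H.iterBracket i α)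
    ring
  · intro α hα
    refine H.mem_exponents_of_iterBracket_ne_zero hs (i := i) fun h => ?_
    rw [Function.mem_support, H.phi_eq hs, h, map_zero, mul_zero, zero_mul] at hα
    exact hα rfl

theorem extremal_eval_zero (v : Fin n → ℝ) (l : List (Fin n)) (Z : PolyField n) :
    eval 0 (H.extremal v l Z) = covector v Z := by
  induction l generalizing Z with
  | nil => exact eval_C _
  | cons j l ih =>
    rw [extremal_cons, Finset.sum_range_succ', map_add, map_sum, Finset.sum_eq_zero]
    · simpa using ih Z
    · intro k _
      simp [divPow]

theorem extremalPoly_zero (hs : 1 ≤ s) (i : Fin n) (v : Fin n → ℝ) :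
    H.extremalPoly i v 0 = v i := by
  rw [H.extremalPoly_eq_eval hs, extremal_eval_zero, covector_apply,
    H.field_at hs (x := 0) fun _ _ => rfl]
  simp [Pi.single_apply]

/-- Consequently the controls of a horizontal curve are the derivatives of its first `r`
coordinates. -/
theorem generator_at_castLE (p q : Fin r) (x : Fin n → ℝ) :
    (H.generator p).at x (Fin.castLE H.rank_le q) = if p = q then 1 else 0 := by
  have h1 : H.multiIndex (Fin.castLE H.rank_le q) = fun _ => 0 := by
    funext j
    rw [multiIndex, H.word_gen]
    exact Multiset.count_zero _
  have h2 : IsDescendant (FreeMagma.of p) (H.word (Fin.castLE H.rank_le q)) ↔ p = q := by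
    rw [H.word_gen]
    refine ⟨fun h => ?_, fun h => h ▸ rfl⟩
    cases h
    rfl
  simp only [PolyField.at, generator, mkDerivation_X, h1, h2]
  split_ifs <;> simp

/-! ### The adjoint system -/

theorem ae_deriv_of_isHorizontal {γ : ℝ → Fin n → ℝ} (hγ : H.IsHorizontal γ) :
    ∀ᵐ t ∂(volume.restrict (Set.Icc (0 : ℝ) 1)), t ∈ Set.Ioo (0 : ℝ) 1 ∧
      HasDerivAt γ (∑ q, deriv (fun τ => γ τ (Fin.castLE H.rank_le q)) t •
        (H.generator q).at (γ t)) t := by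
  obtain ⟨-, h, -, hder⟩ := hγ
  -- Derivatives are two-sided while `lam` is prescribed on `[0,1]` only, so the null set of
  -- endpoints is discarded.
  have hmem : ∀ᵐ t ∂(volume.restrict (Set.Icc (0 : ℝ) 1)), t ∈ Set.Ioo (0 : ℝ) 1 := by
    rw [← restrict_Ioo_eq_restrict_Icc]
    exact ae_restrict_mem measurableSet_Ioo
  filter_upwards [hmem, hder] with t ht hd
  refine ⟨ht, ?_⟩
  have hq : ∀ q, deriv (fun τ => γ τ (Fin.castLE H.rank_le q)) t = h q t := by
    intro q
    rw [(hasDerivAt_pi.1 hd _).deriv]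
    simp [Finset.sum_apply, generator_at_castLE]
  simpa only [hq] using hd

theorem solvesAdjoint_extremalPoly (hs : 1 ≤ s) {γ lam : ℝ → Fin n → ℝ} (hγ : H.IsHorizontal γ)
    {v : Fin n → ℝ}
    (hlam : ∀ i, ∀ t ∈ Set.Icc (0 : ℝ) 1, lam t i = H.extremalPoly i v (γ t)) :
    H.SolvesAdjoint γ lam := by
  intro i
  filter_upwards [H.ae_deriv_of_isHorizontal hγ] with t ⟨ht, hd⟩
  have hev : (fun τ => lam τ i) =ᶠ[nhds t]
      fun τ => eval (γ τ) (H.extremal v (List.finRange n) (H.field i)) := by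
    filter_upwards [Icc_mem_nhds ht.1 ht.2] with τ hτ
    rw [hlam i τ hτ, H.extremalPoly_eq_eval hs]
  refine ((hasDerivAt_eval hd _).congr_of_eventuallyEq hev).congr_deriv ?_
  rw [Finset.sum_comm, ← Finset.sum_neg_distrib]
  refine Finset.sum_congr rfl fun q _ => ?_
  rw [H.generator_extremal_eq_sum hs, map_neg, map_sum, mul_neg, Finset.mul_sum]
  congr 1
  refine Finset.sum_congr rfl fun k _ => ?_
  rw [smul_eval, hlam k t (Set.Ioo_subset_Icc_self ht), H.extremalPoly_eq_eval hs]
  ring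

end HallSystem

/-! ### Uniqueness for the adjoint system -/

theorem absolutelyContinuousOnInterval_eval {n : ℕ} {γ : ℝ → Fin n → ℝ} {K : NNReal}
    (hγ : LipschitzOnWith K γ (Set.Icc 0 1)) (p : MvPolynomial (Fin n) ℝ) :
    AbsolutelyContinuousOnInterval (fun t => eval (γ t) p) 0 1 := by
  induction p using MvPolynomial.induction_on with
  | C a =>
    simp only [eval_C]
    exact ((LipschitzWith.const a).lipschitzOnWith).absolutelyContinuousOnInterval
  | add p q hp hq =>
    simp only [map_add]
    exact hp.add hq
  | mul_X p i hp =>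
    simp only [map_mul, eval_X]
    refine hp.mul (LipschitzOnWith.absolutelyContinuousOnInterval (K := K) ?_)
    rw [Set.uIcc_of_le zero_le_one]
    exact LipschitzOnWith.of_dist_le_mul fun x hx y hy =>
      (dist_le_pi_dist (γ x) (γ y) i).trans (hγ.dist_le_mul x hx y hy)

namespace HallSystem

variable {r s n : ℕ} (H : HallSystem r s n)

/-- The adjoint system is triangular, so its solutions are determined by their initial values. -/
theorem eqOn_of_solvesAdjoint (hs : 1 ≤ s) {γ lam mu : ℝ → Fin n → ℝ}
    (hlam : H.SolvesAdjoint γ lam) (hmu : H.SolvesAdjoint γ mu)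
    (hac : ∀ i, AbsolutelyContinuousOnInterval (fun t => lam t i) 0 1)
    (hac' : ∀ i, AbsolutelyContinuousOnInterval (fun t => mu t i) 0 1)
    (h0 : lam 0 = mu 0) (i : Fin n) : ∀ t ∈ Set.Icc (0 : ℝ) 1, lam t i = mu t i := by
  -- The components are treated from the last index downwards: the equation for `i` involves only
  -- those with `k > i`, where the solutions already agree, so the difference has derivative zero
  -- a.e.
  induction hd : n - i.val using Nat.strong_induction_on generalizing i with
  | _ d ih =>
  subst hd
  have hder : ∀ᵐ t, t ∈ Set.uIcc (0 : ℝ) 1 → HasDerivAt (fun τ => lam τ i - mu τ i) 0 t := by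
    rw [Set.uIcc_of_le zero_le_one, ← ae_restrict_iff' measurableSet_Icc]
    filter_upwards [hlam i, hmu i, ae_restrict_mem measurableSet_Icc] with t h1 h2 ht
    refine (h1.sub h2).congr_deriv ?_
    rw [sub_eq_zero]
    congr 1
    refine Finset.sum_congr rfl fun k _ => Finset.sum_congr rfl fun q _ => ?_
    rcases le_or_gt k i with hk | hk
    · rw [H.structConst_eq_zero hs hk]
      ring
    · rw [ih _ (by have := Fin.lt_def.1 hk; omega) k rfl t ht]
  obtain ⟨c, hc⟩ := ((hac i).sub (hac' i)).const_of_ae_hasDerivAt_zero hder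
  rw [Set.uIcc_of_le zero_le_one] at hc
  intro t ht
  have h1 : lam t i - mu t i = c := hc t ht
  have h2 : lam 0 i - mu 0 i = c := hc 0 ⟨le_rfl, zero_le_one⟩
  rw [h0, sub_self] at h2
  linarith

theorem eq_extremalPoly_of_solvesAdjoint (hs : 1 ≤ s) {γ lam : ℝ → Fin n → ℝ}
    (hγ : H.IsHorizontal γ) (hγ0 : γ 0 = 0) {K : NNReal}
    (hK : LipschitzOnWith K lam (Set.Icc 0 1)) (hlam : H.SolvesAdjoint γ lam) (i : Fin n) :
    ∀ t ∈ Set.Icc (0 : ℝ) 1, lam t i = H.extremalPoly i (lam 0) (γ t) := by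
  obtain ⟨K', hK'⟩ := hγ.1
  refine H.eqOn_of_solvesAdjoint hs (mu := fun t i => H.extremalPoly i (lam 0) (γ t)) hlam
    (H.solvesAdjoint_extremalPoly hs hγ fun _ _ _ => rfl) (fun i => ?_) (fun i => ?_) ?_ i
  · refine LipschitzOnWith.absolutelyContinuousOnInterval (K := K) ?_
    rw [Set.uIcc_of_le zero_le_one]
    exact LipschitzOnWith.of_dist_le_mul fun x hx y hy =>
      (dist_le_pi_dist (lam x) (lam y) i).trans (hK.dist_le_mul x hx y hy)
  · simp only [H.extremalPoly_eq_eval hs]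
    exact absolutelyContinuousOnInterval_eval hK' _
  · funext i
    rw [hγ0, H.extremalPoly_zero hs]

end HallSystem
end HallGG

end

theorem mainTheorem1 (r s n : ℕ) (hr : 2 ≤ r) (hs : 2 ≤ s) (H : HallGG.HallSystem r s n) :
    -- the model and its constants are well defined
    (H.IsFreeNilpotentBasis ∧ H.IsSecondTypeCoordinates ∧
      ∀ i : Fin n, {α : Fin n → ℕ | H.iterBracket i α ≠ 0}.Finite) ∧
    -- integration of the adjoint system
    ∀ γ lam : ℝ → Fin n → ℝ, H.IsHorizontal γ → γ 0 = 0 →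
      (∃ K : NNReal, LipschitzOnWith K lam (Set.Icc 0 1)) →
      (H.SolvesAdjoint γ lam ↔
        ∃ v : Fin n → ℝ, ∀ i : Fin n, ∀ t ∈ Set.Icc (0 : ℝ) 1,
          lam t i = H.extremalPoly i v (γ t)) ∧
      ∀ v : Fin n → ℝ,
        (∀ i : Fin n, ∀ t ∈ Set.Icc (0 : ℝ) 1, lam t i = H.extremalPoly i v (γ t)) →
          v = lam 0 := by
  have hs1 : 1 ≤ s := one_le_two.trans hs
  refine ⟨⟨H.isFreeNilpotentBasis hs1, H.isSecondTypeCoordinates hs1,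
    H.finite_iterBracket_ne_zero hs1⟩, fun γ lam hγ hγ0 ⟨K, hK⟩ => ⟨⟨fun h => ?_, ?_⟩, ?_⟩⟩
  · exact ⟨lam 0, H.eq_extremalPoly_of_solvesAdjoint hs1 hγ hγ0 hK h⟩
  · rintro ⟨v, hv⟩
    exact H.solvesAdjoint_extremalPoly hs1 hγ hv
  · intro v hv
    funext i
    rw [hv i 0 ⟨le_rfl, zero_le_one⟩, hγ0, H.extremalPoly_zero hs1]
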